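/- Let $k\ge 1$, let $Z_1,Z_2,\dots$ be independent real random variables on a probability space, and let $X_i=h_i(Z_i,\dots,Z_{i+k-1})$, $i=1,\dots,n$, where the $h_i:\mathbb R^k\to\mathbb Z$ are measurable and the $X_i$ are non-negative with $E X_i^2<\infty$; put $X_i=0$ for $i<1$. Let $p_i=P(X_i\neq 0)$, $\lambda_n=\sum_{i=1}^n p_i$, $F_n=\sum_{i=1}^n\frac{p_i}{\lambda_n}G_i$, where $G_i$ is the conditional law of $X_i$ given $X_i\ne 0$. Let $CP(\lambda,F)$ denote the law of $\sum_{i=1}^N Y_i$ with $N\sim Po(\lambda)$ and $Y_1,Y_2,\dots$ i.i.d. with law $F$, independent of $N$ (so $CP(0,\cdot)$ is the point mass at $0$), $f_{CP(\lambda,F)}:\mathbb Z\to[0,1]$ its probability function, $\Delta f(z)=f(z)-f(z-1)$, $\|g\|_1=\sum_{z\in\mathbb Z}|g(z)|$, and $d_{TV}(P,Q)=\sup_{A\subseteq\mathbb Z}|P(A)-Q(A)|$. Empty sums are $0$. Suppose that $m:=\max_{1\le i\le n}\sum_{j=i-3k+3}^{i}p_j<\log 2$. (a) Then $$d_{TV}\Bigl(\mathcal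 L\sum_{i=1}^nX_i,\,CP(\lambda_n,F_n)\Bigr)\le C_n+\frac{\|\Delta^2 f_{CP(\lambda_n,F_n)}\|_1}{2(1-2(1-e^{-m}))}\sum_{i=1}^n\Bigl(\sum_{j=i-k+1}^{i-1}\bigl(E(X_iX_j)+E(X_i)E(X_j)\bigr)+\tfrac12 (EX_i)^2\Bigr),$$ where $$C_n=2\sum_{i=1}^n\Bigl(2\sum_{j=1}^{i-3k+2}\Bigl(\sum_{t=j-k+1}^{j-1}\bigl(P(X_tX_j\ne0)+p_tp_j\bigr)+\tfrac12p_j^2\Bigr)+\sum_{j=i-3k+3}^{i-2k+1}p_j\Bigr)\Bigl(2\sum_{j=i-k+1}^{i-1}\bigl(P(X_j\neq0,X_i\ne0)+p_ip_j\bigr)+p_i^2\Bigr).$$ (b) Call real random variables $Y_1,Y_2$ positively (negatively) quadrant dependent, PQD (NQD), if $P(Y_1\ge x_1,Y_2\ge x_2)\ge$ (respectively $\le$) $P(Y_1\ge x_1)P(Y_2\ge x_2)$ for all $x_1,x_2\in\mathbb R$. If, in addition, for every $1\le j<i\le n$ the random variables $X_j+\dots+X_{i-1}$ and $X_i$ are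 PQD or NQD, then $$d_{TV}\Bigl(\mathcal L\sum_{i=1}^nX_i,\,CP(\lambda_n,F_n)\Bigr)\le C_n'+\frac{\|\Delta^2 f_{CP(\lambda_n,F_n)}\|_1}{2(1-2(1-e^{-m}))}\sum_{i=1}^n\Bigl(\sum_{j=i-k+1}^{i-1}|\operatorname{Cov}(X_i,X_j)|+\tfrac12 (EX_i)^2\Bigr),$$ where $$C_n'=2\sum_{i=1}^n\Bigl(2\sum_{j=1}^{i-3k+2}\Bigl(\sum_{t=j-k+1}^{j-1}|\operatorname{Cov}(X_j,X_t)|+\tfrac12(EX_j)^2\Bigr)+\sum_{j=i-3k+3}^{i-2k+1}p_j\Bigr)\Bigl(2\sum_{j=i-k+1}^{i-1}\bigl(P(X_j\neq0,X_i\ne0)+p_ip_j\bigr)+p_i^2\Bigr).$$ -/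

import Mathlib

open MeasureTheory ProbabilityTheory

noncomputable section

/-- Total variation distance `sup_{A ⊆ ℤ} |P(A) - Q(A)|` of two laws on the integers. -/
def dTV (P Q : Measure ℤ) : ℝ := ⨆ A : Set ℤ, |P.real A - Q.real A|

/-- The law of `Y₁ + ⋯ + Y_r` with `Y₁, …, Y_r` i.i.d. with law `F`. -/
def iidSumLaw (F : Measure ℤ) (r : ℕ) : Measure ℤ :=
  (Measure.pi fun _ : Fin r => F).map fun y => ∑ s, y s

/-- The compound Poisson law `CP(a, F)`: the law of `Y₁ + ⋯ + Y_N`, where `N` is Poisson with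
mean `a ≥ 0` and `Y₁, Y₂, …` are i.i.d. with law `F`, independent of `N`. -/
def compoundPoisson (a : ℝ) (F : Measure ℤ) : Measure ℤ :=
  (poissonMeasure a.toNNReal).bind (iidSumLaw F)

/-- The probability function `z ↦ P({z})` of a law on the integers. -/
def probFun (P : Measure ℤ) (z : ℤ) : ℝ := P.real {z}

/-- The backward difference `Δf(z) = f(z) - f(z - 1)`. -/
def backDiff (f : ℤ → ℝ) (z : ℤ) : ℝ := f z - f (z - 1)

/-- The norm `‖g‖₁ = ∑_{z ∈ ℤ} |g(z)|` (only used for summable `g`). -/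
def l1Norm (g : ℤ → ℝ) : ℝ := ∑' z, |g z|

/-- The smoothness factor `‖Δ² f_P‖₁`, where `f_P` is the probability function of `P`. -/
def smoothnessFactor (P : Measure ℤ) : ℝ := l1Norm (backDiff (backDiff (probFun P)))

section

variable {Ω : Type*} [MeasurableSpace Ω]

/-- `P(Y ≠ 0)`. -/
def probNonzero (μ : Measure Ω) (Y : Ω → ℤ) : ℝ := μ.real {ω | Y ω ≠ 0}

/-- The conditional law of `Y` given `Y ≠ 0` (the zero measure if `P(Y ≠ 0) = 0`; it then enters
below with weight zero only). -/
def lawGivenNonzero (μ : Measure Ω) (Y : Ω → ℤ) : Measure ℤ :=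
  (ProbabilityTheory.cond μ {ω | Y ω ≠ 0}).map Y

/-- `λ_n = p_1 + ⋯ + p_n` with `p_i = P(X_i ≠ 0)`. -/
def cpRate (μ : Measure Ω) (X : ℤ → Ω → ℤ) (n : ℕ) : ℝ :=
  ∑ i ∈ Finset.Icc (1 : ℤ) n, probNonzero μ (X i)

/-- `F_n = ∑_{i=1}^n (p_i / λ_n) G_i`, where `G_i` is the conditional law of `X_i` given
`X_i ≠ 0`. If `λ_n = 0` this is the zero measure, and `compoundPoisson 0 F_n` is the point mass
at `0`, as it should be. -/
def cpJumpLaw (μ : Measure Ω) (X : ℤ → Ω → ℤ) (n : ℕ) : Measure ℤ :=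
  ∑ i ∈ Finset.Icc (1 : ℤ) n,
    ENNReal.ofReal (probNonzero μ (X i) / cpRate μ X n) • lawGivenNonzero μ (X i)

/-- The approximating law `CP(λ_n, F_n)`. -/
def cpApprox (μ : Measure Ω) (X : ℤ → Ω → ℤ) (n : ℕ) : Measure ℤ :=
  compoundPoisson (cpRate μ X n) (cpJumpLaw μ X n)

/-- `m = max_{1 ≤ i ≤ n} ∑_{j=i-3k+3}^{i} p_j` (the supremum of a finite family). -/
def maxWindow (μ : Measure Ω) (X : ℤ → Ω → ℤ) (k n : ℕ) : ℝ :=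
  ⨆ i : Finset.Icc (1 : ℤ) n,
    ∑ j ∈ Finset.Icc ((i : ℤ) - 3 * k + 3) (i : ℤ), probNonzero μ (X j)

/-- Positive quadrant dependence. -/
def IsPQD (μ : Measure Ω) (Y₁ Y₂ : Ω → ℝ) : Prop :=
  ∀ x₁ x₂ : ℝ, μ.real {ω | x₁ ≤ Y₁ ω} * μ.real {ω | x₂ ≤ Y₂ ω} ≤
    μ.real {ω | x₁ ≤ Y₁ ω ∧ x₂ ≤ Y₂ ω}

/-- Negative quadrant dependence. -/
def IsNQD (μ : Measure Ω) (Y₁ Y₂ : Ω → ℝ) : Prop :=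
  ∀ x₁ x₂ : ℝ, μ.real {ω | x₁ ≤ Y₁ ω ∧ x₂ ≤ Y₂ ω} ≤
    μ.real {ω | x₁ ≤ Y₁ ω} * μ.real {ω | x₂ ≤ Y₂ ω}

end

end

/-! A law on `ℤ` is encoded by its transform `E χ(Y)`, where `χ z` is translation by `z`, an element
of a commutative Banach algebra of operators. Total variation is at most half the operator norm of
the difference of transforms (`dTV_le_norm_sub`), and the approximating law becomes `exp (∑ (E
χ(X_l) - 1))` (`BddChar.mean_cpApprox`). Everything between these two facts uses only that `χ` is a
bounded character.

Lindeberg telescoping (`mean_sub_exp_eq_sum`) writes the difference as a sum of replacement errors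
`R_i`, each times the exponential of the terms after `i`. Each `R_i` consists of a dependence error,
carried by the `k - 1` left neighbours of `X_i`, and a second order Taylor error of the exponential.
It admits two estimates: a crude one, and a smooth one that extracts the factor `(χ 1 - 1)^2`, a
second difference.

The smooth estimate helps only if that factor meets the transform of the whole approximating law. So
`R_i` is first replaced by `E χ(X_1 + ⋯ + X_{i-3k+2})` times a local error `T_i` that starts at `i -
2k + 2`. The two are independent across a gap of `k - 1` indices, and the cost is proportional to
the probability that the gap sum is non-zero (`norm_replacement_sub_le`). Next the distant past is
replaced by its exponential, using the crude estimate (`norm_mean_sub_exp_sum_le`). Both costs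
multiply a bound for a local error; together they form `C_n`. What remains is `T_i` times the full
exponential without the window from `i - 3k + 3` to `i`. Restoring the window costs the factor `1 /
(1 - 2(1 - e^{-m}))`, positive because `m < log 2` (`norm_mul_exp_window_le`), and `(χ 1 - 1)^2`
times the full exponential is bounded by `‖Δ² f‖₁` (`norm_sq_mul_mean_le`).

Parts (a) and (b) differ only in the estimates of `R_i`. In (a) geometric sums are bounded in
absolute value; in (b) Hoeffding's covariance identity applies, whose terms have one sign under
quadrant dependence. -/

noncomputable section

set_option linter.unusedSectionVars false

/-! ### Exponentials in a commutative Banach algebra, and bounded characters of `ℤ` -/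

section BanachAlgebra

variable {𝔸 : Type*} [NormedCommRing 𝔸] [NormedAlgebra ℝ 𝔸] [CompleteSpace 𝔸] [NormOneClass 𝔸]

open NormedSpace

theorem banach_exp_add (x y : 𝔸) : exp (x + y) = exp x * exp y := by
  let _ : NormedAlgebra ℚ 𝔸 := NormedAlgebra.restrictScalars ℚ ℝ 𝔸
  exact exp_add

theorem banach_norm_exp_sub_one_le (x : 𝔸) : ‖exp x - 1‖ ≤ Real.exp ‖x‖ - 1 := by
  have h1 : HasSum (fun n : ℕ => ((n + 1).factorial⁻¹ : ℝ) • x ^ (n + 1)) (exp x - 1) := by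
    have := (hasSum_nat_add_iff' (f := fun n : ℕ => (n.factorial⁻¹ : ℝ) • x ^ n) 1).2
      (exp_series_hasSum_exp' (𝕂 := ℝ) x)
    simpa using this
  have h2 : HasSum (fun n : ℕ => ((n + 1).factorial⁻¹ : ℝ) • ‖x‖ ^ (n + 1))
      (Real.exp ‖x‖ - 1) := by
    have := (hasSum_nat_add_iff' (f := fun n : ℕ => (n.factorial⁻¹ : ℝ) • ‖x‖ ^ n) 1).2
      (exp_series_hasSum_exp' (𝕂 := ℝ) ‖x‖)
    rw [Real.exp_eq_exp_ℝ]
    simpa using this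
  refine h1.norm_le_of_bounded h2 fun n => ?_
  rw [norm_smul, Real.norm_of_nonneg (by positivity), smul_eq_mul]
  gcongr
  exact norm_pow_le _ _

theorem banach_norm_exp_le (x : 𝔸) : ‖exp x‖ ≤ Real.exp ‖x‖ := by
  have h := banach_norm_exp_sub_one_le x
  have h2 := norm_add_le (exp x - 1) 1
  rw [sub_add_cancel, norm_one] at h2
  linarith

theorem banach_exp_sub_smul_one (r : 𝔸) (c : ℝ) :
    exp (r - c • (1 : 𝔸)) = Real.exp (-c) • exp r := by
  rw [sub_eq_add_neg, banach_exp_add, ← neg_smul, ← Algebra.algebraMap_eq_smul_one,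
    ← algebraMap_exp_comm (𝕂 := ℝ) (𝔸 := 𝔸), ← Real.exp_eq_exp_ℝ, mul_comm,
    Algebra.smul_def]

/-- The identity part leaves the exponential as the scalar `e^{-c}`, which compensates `‖exp r‖ ≤
e^c`. This is the contractivity of compound Poisson transforms. -/
theorem banach_norm_exp_sub_smul_one_le {r : 𝔸} {c : ℝ} (h : ‖r‖ ≤ c) :
    ‖exp (r - c • (1 : 𝔸))‖ ≤ 1 := by
  rw [banach_exp_sub_smul_one, norm_smul, Real.norm_of_nonneg (Real.exp_nonneg _)]
  calc Real.exp (-c) * ‖exp r‖ ≤ Real.exp (-c) * Real.exp c := by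
        gcongr
        exact (banach_norm_exp_le r).trans (Real.exp_le_exp.2 h)
    _ = 1 := by rw [← Real.exp_add]; simp

theorem banach_norm_exp_sub_one_le_one {u : 𝔸} (h : ‖u‖ ≤ 1) : ‖exp (u - 1)‖ ≤ 1 := by
  simpa using banach_norm_exp_sub_smul_one_le (c := 1) h

/-- Second order Taylor expansion of the exponential at a dissipative element `u - 1`. -/
theorem banach_exists_exp_eq {u : 𝔸} (h : ‖u‖ ≤ 1) :
    ∃ e : 𝔸, ‖e‖ ≤ 1 / 2 ∧ exp (u - 1) = u + (u - 1) ^ 2 * e := by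
  set q : 𝔸 := u - 1 with hq
  have hexp : ∀ s : ℝ, HasDerivAt (fun s : ℝ => exp (s • q)) (exp (s • q) * q) s :=
    fun s => hasDerivAt_exp_smul_const q s
  have hcont : Continuous fun s : ℝ => exp (s • q) :=
    continuous_iff_continuousAt.2 fun s => (hexp s).continuousAt
  have hbd : ∀ s : ℝ, 0 ≤ s → ‖exp (s • q)‖ ≤ 1 := fun s hs => by
    rw [hq, smul_sub]
    refine banach_norm_exp_sub_smul_one_le ?_
    rw [norm_smul, Real.norm_of_nonneg hs]
    exact mul_le_of_le_one_right hs h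
  -- Integral form of the Taylor remainder. As `exp (s q)` is contractive, its norm is at most `∫ (1
  -- - s) = 1/2`.
  refine ⟨∫ s in (0 : ℝ)..1, (1 - s) • exp (s • q), ?_, ?_⟩
  · have h1 : ‖∫ s in (0 : ℝ)..1, (1 - s) • exp (s • q)‖ ≤ ∫ s in (0 : ℝ)..1, (1 - s) := by
      refine intervalIntegral.norm_integral_le_of_norm_le zero_le_one ?_
        (Continuous.intervalIntegrable (by fun_prop) _ _)
      refine Filter.Eventually.of_forall fun s hs => ?_
      rw [norm_smul, Real.norm_of_nonneg (by linarith [hs.2])]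
      exact mul_le_of_le_one_right (by linarith [hs.2]) (hbd s hs.1.le)
    refine h1.trans (le_of_eq ?_)
    rw [intervalIntegral.integral_sub (by simp) (by simp)]
    simp
    norm_num
  -- This antiderivative equals `exp q` at `1` and `q + 1 = u` at `0`.
  · have hF : ∀ s : ℝ, HasDerivAt (fun s : ℝ => (1 - s) • (exp (s • q) * q) + exp (s • q))
        (q ^ 2 * ((1 - s) • exp (s • q))) s := fun s => by
      have h1 : HasDerivAt (fun s : ℝ => 1 - s) (-1) s := by
        simpa using (hasDerivAt_id s).const_sub 1
      have h2 := (h1.smul ((hexp s).mul_const q)).add (hexp s)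
      convert! h2 using 1
      rw [neg_smul, one_smul, mul_smul_comm]
      have : q ^ 2 * exp (s • q) = exp (s • q) * q * q := by ring
      rw [this]
      abel
    have hint := intervalIntegral.integral_eq_sub_of_hasDerivAt (a := 0) (b := 1)
      (fun s _ => hF s) (Continuous.intervalIntegrable (by fun_prop) _ _)
    have hmul : ∫ s in (0 : ℝ)..1, q ^ 2 * ((1 - s) • exp (s • q))
        = q ^ 2 * ∫ s in (0 : ℝ)..1, (1 - s) • exp (s • q) := by
      have := ContinuousLinearMap.intervalIntegral_comp_comm (μ := volume) (a := 0) (b := 1)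
        (ContinuousLinearMap.mul ℝ 𝔸 (q ^ 2))
        (f := fun s : ℝ => (1 - s) • exp (s • q))
        (Continuous.intervalIntegrable (by fun_prop) _ _)
      simpa using this
    rw [← hmul, hint]
    simp [exp_zero]
    rw [hq]
    ring

/-- Removing a factor `exp (r - c)` with `‖r‖ ≤ c` from a product costs at most a factor
`2 * exp (-c) - 1` in the norm. -/
theorem banach_norm_mul_exp_ge (A : 𝔸) {r : 𝔸} {c : ℝ} (h : ‖r‖ ≤ c) :
    (1 - 2 * (1 - Real.exp (-c))) * ‖A‖ ≤ ‖A * exp (r - c • (1 : 𝔸))‖ := by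
  rw [banach_exp_sub_smul_one]
  -- Insert `1 = exp r - (exp r - 1)`: the error `e^{-c} (exp r - 1)` has norm at most `1 - e^{-c}`,
  -- which leaves `e^{-c} - (1 - e^{-c})` in front of `‖A‖`.
  have h1 : Real.exp (-c) • A
      = A * (Real.exp (-c) • exp r) - A * (Real.exp (-c) • (exp r - 1)) := by
    simp only [mul_smul_comm, mul_sub, smul_sub, mul_one]
    abel
  have h2 : ‖A * (Real.exp (-c) • (exp r - 1))‖ ≤ ‖A‖ * (1 - Real.exp (-c)) := by
    refine (norm_mul_le _ _).trans ?_
    gcongr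
    rw [norm_smul, Real.norm_of_nonneg (Real.exp_nonneg _)]
    calc Real.exp (-c) * ‖exp r - 1‖ ≤ Real.exp (-c) * (Real.exp c - 1) := by
          gcongr
          refine (banach_norm_exp_sub_one_le r).trans ?_
          gcongr
      _ = 1 - Real.exp (-c) := by
          rw [mul_sub, ← Real.exp_add]; simp
  have h3 : Real.exp (-c) * ‖A‖ = ‖Real.exp (-c) • A‖ := by
    rw [norm_smul, Real.norm_of_nonneg (Real.exp_nonneg _)]
  have h4 := norm_sub_le (A * (Real.exp (-c) • exp r)) (A * (Real.exp (-c) • (exp r - 1)))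
  rw [← h1, ← h3] at h4
  nlinarith

/-- A bounded character of the group `ℤ` in a normed ring. -/
structure BddChar (𝔸 : Type*) [NormedCommRing 𝔸] where
  toFun : ℤ → 𝔸
  map_zero : toFun 0 = 1
  map_add : ∀ a b, toFun (a + b) = toFun a * toFun b
  norm_le : ∀ a, ‖toFun a‖ ≤ 1

namespace BddChar

variable (χ : BddChar 𝔸)

instance : CoeFun (BddChar 𝔸) fun _ => ℤ → 𝔸 := ⟨BddChar.toFun⟩

/-- The geometric sum `1 + χ 1 + ⋯ + χ (z - 1)`. -/
def geo (z : ℤ) : 𝔸 := ∑ a ∈ Finset.range z.toNat, χ a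

theorem norm_geo_le {z : ℤ} (hz : 0 ≤ z) : ‖χ.geo z‖ ≤ z := by
  refine (norm_sum_le_of_le (Finset.range z.toNat) fun a _ => χ.norm_le a).trans ?_
  have : ((z.toNat : ℕ) : ℝ) = z := by exact_mod_cast Int.toNat_of_nonneg hz
  rw [Finset.sum_const, Finset.card_range, nsmul_eq_mul, mul_one, this]

/-- A geometric sum telescopes. For non-negative `z` this extracts one difference `χ 1 - 1` at the
price of a cofactor of norm at most `z`, which is how first and second moments enter. -/
theorem sub_one_eq {z : ℤ} (hz : 0 ≤ z) : χ z - 1 = (χ 1 - 1) * χ.geo z := by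
  obtain ⟨n, rfl⟩ := Int.eq_ofNat_of_zero_le hz
  simp only [geo, Int.toNat_natCast]
  induction n with
  | zero => simp [χ.map_zero]
  | succ n ih =>
    have ih := ih (by positivity)
    rw [Finset.sum_range_succ, mul_add, ← ih]
    push_cast
    rw [χ.map_add]
    ring

theorem norm_sub_one_le_two (z : ℤ) : ‖χ z - 1‖ ≤ 2 := by
  refine (norm_sub_le _ _).trans ?_
  rw [norm_one]
  linarith [χ.norm_le z]

end BddChar

end BanachAlgebra

/-! ### Transforms of integer random variables -/

section CharMean

open NormedSpace

variable {𝔸 : Type*} [NormedCommRing 𝔸] [NormedAlgebra ℝ 𝔸] [CompleteSpace 𝔸] [NormOneClass 𝔸]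
variable {Ω : Type*} [MeasurableSpace Ω] {μ : Measure Ω} [IsProbabilityMeasure μ]

/-- Countability of the source makes every function strongly measurable, so no separability of the
algebra is needed. -/
theorem stronglyMeasurable_comp_discrete {α E : Type*} [Countable α] [MeasurableSpace α]
    [MeasurableSingletonClass α] [NormedAddCommGroup E] {ξ : Ω → α} (hξ : Measurable ξ)
    (a : α → E) : StronglyMeasurable fun ω => a (ξ ω) :=
  (StronglyMeasurable.of_discrete (f := a)).comp_measurable hξ

theorem integrable_comp_discrete {α E : Type*} [Countable α] [MeasurableSpace α]
    [MeasurableSingletonClass α] [NormedAddCommGroup E] {ξ : Ω → α} (hξ : Measurable ξ)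
    {a : α → E} {C : ℝ} (ha : ∀ x, ‖a x‖ ≤ C) : Integrable (fun ω => a (ξ ω)) μ :=
  Integrable.of_bound (stronglyMeasurable_comp_discrete hξ a).aestronglyMeasurable C
    (Filter.Eventually.of_forall fun _ => ha _)

theorem integral_mul_comp_of_indepFun {B : Type*} [NormedCommRing B] [NormedAlgebra ℝ B]
    [CompleteSpace B] {α β : Type*} [Countable α] [MeasurableSpace α]
    [MeasurableSingletonClass α] [Countable β] [MeasurableSpace β] [MeasurableSingletonClass β]
    {ξ : Ω → α} {η : Ω → β} (h : IndepFun ξ η μ) (hξ : Measurable ξ) (hη : Measurable η)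
    {a : α → B} {b : β → B} {C D : ℝ} (ha : ∀ x, ‖a x‖ ≤ C) (hb : ∀ x, ‖b x‖ ≤ D) :
    ∫ ω, a (ξ ω) * b (η ω) ∂μ = (∫ ω, a (ξ ω) ∂μ) * ∫ ω, b (η ω) ∂μ := by
  have h1 : Integrable a (μ.map ξ) :=
    (integrable_map_measure StronglyMeasurable.of_discrete.aestronglyMeasurable
      hξ.aemeasurable).2 (integrable_comp_discrete hξ ha)
  have h2 : Integrable b (μ.map η) :=
    (integrable_map_measure StronglyMeasurable.of_discrete.aestronglyMeasurable
      hη.aemeasurable).2 (integrable_comp_discrete hη hb)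
  exact h.integral_bilin_comp_comp hξ.aemeasurable hη.aemeasurable h1 h2
    (ContinuousLinearMap.mul ℝ B)

theorem measurableSet_ne_zero {Y : Ω → ℤ} (hY : Measurable Y) : MeasurableSet {ω | Y ω ≠ 0} :=
  hY (MeasurableSet.of_discrete (s := {z : ℤ | z ≠ 0}))

theorem integral_indicator_ne_zero {Y : Ω → ℤ} (hY : Measurable Y) :
    ∫ ω, (if Y ω ≠ 0 then (1 : ℝ) else 0) ∂μ = probNonzero μ Y := by
  have : (fun ω => if Y ω ≠ 0 then (1 : ℝ) else 0) = {ω | Y ω ≠ 0}.indicator 1 := by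
    ext ω; simp [Set.indicator]
  rw [this, integral_indicator_one (measurableSet_ne_zero hY), probNonzero]

namespace BddChar

variable (χ : BddChar 𝔸)

/-- The transform `E χ(Y)` of the law of an integer random variable. -/
def mean (μ : Measure Ω) (Y : Ω → ℤ) : 𝔸 := ∫ ω, χ (Y ω) ∂μ

/-- The restriction of `E χ(Y)` to the event `Y ≠ 0`. -/
def jumpMean (μ : Measure Ω) (Y : Ω → ℤ) : 𝔸 := ∫ ω, (if Y ω ≠ 0 then χ (Y ω) else 0) ∂μ

theorem integrable_comp {Y : Ω → ℤ} (hY : Measurable Y) : Integrable (fun ω => χ (Y ω)) μ :=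
  integrable_comp_discrete hY χ.norm_le

theorem norm_mean_le (Y : Ω → ℤ) : ‖χ.mean μ Y‖ ≤ 1 := by
  refine (norm_integral_le_of_norm_le_const (C := 1)
    (Filter.Eventually.of_forall fun _ => χ.norm_le _)).trans ?_
  simp

theorem norm_ite_le (z : ℤ) : ‖if z ≠ 0 then χ z else 0‖ ≤ if z ≠ 0 then (1 : ℝ) else 0 := by
  split_ifs
  · exact χ.norm_le z
  · simp

theorem norm_ite_le_one (z : ℤ) : ‖if z ≠ 0 then χ z else 0‖ ≤ 1 :=
  (χ.norm_ite_le z).trans (by split_ifs <;> norm_num)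

theorem integrable_ite_ne_zero {Y : Ω → ℤ} (hY : Measurable Y) :
    Integrable (fun ω => if Y ω ≠ 0 then (1 : ℝ) else 0) μ :=
  integrable_comp_discrete (a := fun z : ℤ => if z ≠ 0 then (1 : ℝ) else 0) (C := 1) hY
    fun z => by split_ifs <;> simp

theorem norm_jumpMean_le {Y : Ω → ℤ} (hY : Measurable Y) :
    ‖χ.jumpMean μ Y‖ ≤ probNonzero μ Y := by
  rw [← integral_indicator_ne_zero hY]
  exact norm_integral_le_of_norm_le (integrable_ite_ne_zero hY)
    (Filter.Eventually.of_forall fun _ => χ.norm_ite_le _)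

/-- This is the shape `r - c • 1` with `‖r‖ ≤ c` that the exponential estimates require, with `c =
P(Y ≠ 0)`. -/
theorem mean_sub_one_eq {Y : Ω → ℤ} (hY : Measurable Y) :
    χ.mean μ Y - 1 = χ.jumpMean μ Y - probNonzero μ Y • (1 : 𝔸) := by
  have h1 : Integrable (fun ω => if Y ω ≠ 0 then χ (Y ω) else 0) μ :=
    integrable_comp_discrete (a := fun z : ℤ => if z ≠ 0 then χ z else 0) hY χ.norm_ite_le_one
  have h2 : Integrable (fun ω => (if Y ω ≠ 0 then (1 : ℝ) else 0) • (1 : 𝔸)) μ :=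
    (integrable_ite_ne_zero hY).smul_const _
  rw [mean, jumpMean, ← integral_indicator_ne_zero hY, ← integral_smul_const,
    ← integral_sub h1 h2]
  have h3 : (1 : 𝔸) = ∫ _, (1 : 𝔸) ∂μ := by simp
  conv_lhs => rw [h3, ← integral_sub (χ.integrable_comp hY) (integrable_const _)]
  congr 1
  ext ω
  by_cases h : Y ω = 0 <;> simp [h, χ.map_zero]

theorem norm_mean_sub_one_le {Y : Ω → ℤ} (hY : Measurable Y) :
    ‖χ.mean μ Y - 1‖ ≤ 2 * probNonzero μ Y := by
  have h0 : 0 ≤ probNonzero μ Y := measureReal_nonneg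
  rw [χ.mean_sub_one_eq hY]
  refine (norm_sub_le _ _).trans ?_
  have h := χ.norm_jumpMean_le (μ := μ) hY
  rw [norm_smul, norm_one, Real.norm_of_nonneg h0]
  linarith

theorem integrable_geo {Y : Ω → ℤ} (hY : Measurable Y) (h0 : ∀ ω, 0 ≤ Y ω)
    (hi : Integrable (fun ω => (Y ω : ℝ)) μ) : Integrable (fun ω => χ.geo (Y ω)) μ :=
  hi.mono' (stronglyMeasurable_comp_discrete hY _).aestronglyMeasurable
    (Filter.Eventually.of_forall fun ω => χ.norm_geo_le (h0 ω))

theorem norm_integral_geo_le {Y : Ω → ℤ} (h0 : ∀ ω, 0 ≤ Y ω)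
    (hi : Integrable (fun ω => (Y ω : ℝ)) μ) :
    ‖∫ ω, χ.geo (Y ω) ∂μ‖ ≤ ∫ ω, (Y ω : ℝ) ∂μ :=
  norm_integral_le_of_norm_le hi (Filter.Eventually.of_forall fun ω => χ.norm_geo_le (h0 ω))

theorem mean_sub_one_eq_mul_geo {Y : Ω → ℤ} (hY : Measurable Y) (h0 : ∀ ω, 0 ≤ Y ω)
    (hi : Integrable (fun ω => (Y ω : ℝ)) μ) :
    χ.mean μ Y - 1 = (χ 1 - 1) * ∫ ω, χ.geo (Y ω) ∂μ := by
  have h3 : (1 : 𝔸) = ∫ _, (1 : 𝔸) ∂μ := by simp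
  rw [← integral_const_mul_of_integrable (χ.integrable_geo hY h0 hi), mean]
  conv_lhs => rw [h3, ← integral_sub (χ.integrable_comp hY) (integrable_const _)]
  congr 1
  ext ω
  exact χ.sub_one_eq (h0 ω)

theorem norm_exp_mean_sub_one_le (Y : Ω → ℤ) : ‖exp (χ.mean μ Y - 1)‖ ≤ 1 :=
  banach_norm_exp_sub_one_le_one (χ.norm_mean_le Y)

theorem norm_mean_sub_exp_le {Y : Ω → ℤ} (hY : Measurable Y) :
    ‖χ.mean μ Y - exp (χ.mean μ Y - 1)‖ ≤ 2 * probNonzero μ Y ^ 2 := by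
  obtain ⟨e, he, h⟩ := banach_exists_exp_eq (χ.norm_mean_le (μ := μ) Y)
  rw [h, sub_add_cancel_left, norm_neg]
  have h1 := χ.norm_mean_sub_one_le (μ := μ) hY
  calc ‖(χ.mean μ Y - 1) ^ 2 * e‖ ≤ ‖χ.mean μ Y - 1‖ ^ 2 * ‖e‖ :=
        (norm_mul_le _ _).trans (by gcongr; exact norm_pow_le _ _)
    _ ≤ (2 * probNonzero μ Y) ^ 2 * (1 / 2) := by gcongr
    _ = 2 * probNonzero μ Y ^ 2 := by ring

/-- The Taylor error is quadratic in `E χ(Y) - 1`, and each of the two factors yields a `χ 1 - 1`.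
-/
theorem exists_mean_sub_exp_eq {Y : Ω → ℤ} (hY : Measurable Y) (h0 : ∀ ω, 0 ≤ Y ω)
    (hi : Integrable (fun ω => (Y ω : ℝ)) μ) :
    ∃ κ : 𝔸, ‖κ‖ ≤ 1 / 2 * (∫ ω, (Y ω : ℝ) ∂μ) ^ 2 ∧
      χ.mean μ Y - exp (χ.mean μ Y - 1) = (χ 1 - 1) ^ 2 * κ := by
  obtain ⟨e, he, h⟩ := banach_exists_exp_eq (χ.norm_mean_le (μ := μ) Y)
  refine ⟨-((∫ ω, χ.geo (Y ω) ∂μ) ^ 2 * e), ?_, ?_⟩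
  · rw [norm_neg]
    calc ‖(∫ ω, χ.geo (Y ω) ∂μ) ^ 2 * e‖ ≤ ‖∫ ω, χ.geo (Y ω) ∂μ‖ ^ 2 * ‖e‖ :=
        (norm_mul_le _ _).trans (by gcongr; exact norm_pow_le _ _)
      _ ≤ (∫ ω, (Y ω : ℝ) ∂μ) ^ 2 * (1 / 2) := by
        gcongr
        exact χ.norm_integral_geo_le h0 hi
      _ = _ := by ring
  · rw [h, χ.mean_sub_one_eq_mul_geo hY h0 hi]
    ring

end BddChar

end CharMean

/-! ### Block sums of locally dependent variables and the local interaction -/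

section LocalDependence

open NormedSpace Finset

variable {𝔸 : Type*} [NormedCommRing 𝔸] [NormedAlgebra ℝ 𝔸] [CompleteSpace 𝔸] [NormOneClass 𝔸]
variable {Ω : Type*} [MeasurableSpace Ω] {μ : Measure Ω} [IsProbabilityMeasure μ]

/-- Non-negative square-integrable integer random variables `X_i`, `i ≤ n`, vanishing for `i < 1`,
such that `(X_i)_{i ≤ c}` and `(X_i)_{i ≥ c + k}` are independent for all `c`. -/
structure LocallyDependent (μ : Measure Ω) (X : ℤ → Ω → ℤ) (k n : ℕ) : Prop where
  meas : ∀ i : ℤ, i ≤ n → Measurable (X i)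
  nonneg : ∀ i : ℤ, i ≤ n → ∀ ω, 0 ≤ X i ω
  zero : ∀ i : ℤ, i < 1 → ∀ ω, X i ω = 0
  memLp : ∀ i : ℤ, i ≤ n → MemLp (fun ω => (X i ω : ℝ)) 2 μ
  indep : ∀ c : ℤ, IndepFun (fun ω (i : ℤ) => if i ≤ c ∧ i ≤ n then X i ω else 0)
    (fun ω (i : ℤ) => if c + k ≤ i ∧ i ≤ n then X i ω else 0) μ

/-- The block sum `X_a + ⋯ + X_b`. -/
def blockSum (X : ℤ → Ω → ℤ) (a b : ℤ) (ω : Ω) : ℤ := ∑ t ∈ Icc a b, X t ω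

theorem blockSum_add (X : ℤ → Ω → ℤ) {a r s : ℤ} (h1 : a ≤ r + 1) (h2 : r ≤ s) (ω : Ω) :
    blockSum X a s ω = blockSum X a r ω + blockSum X (r + 1) s ω := by
  have h : Icc a s = Icc a r ∪ Icc (r + 1) s := by
    ext x; simp only [mem_Icc, mem_union]; omega
  rw [blockSum, h, sum_union]
  · rfl
  · rw [disjoint_left]; intro x; simp only [mem_Icc]; omega

theorem blockSum_succ (X : ℤ → Ω → ℤ) {a i : ℤ} (h : a ≤ i) (ω : Ω) :
    blockSum X a i ω = blockSum X a (i - 1) ω + X i ω := by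
  rw [blockSum_add X (r := i - 1) (by omega) (by omega)]
  simp [blockSum]

namespace LocallyDependent

variable {X : ℤ → Ω → ℤ} {k n : ℕ} (hX : LocallyDependent μ X k n)
include hX

/-- Because `X_i = 0` for `i < 1`, a sum from `1` may be regarded as starting early enough to
contain all left neighbours of `X_i`, even when `i < k`. -/
theorem blockSum_eq_of_le_one {a : ℤ} (ha : a ≤ 1) (r : ℤ) (ω : Ω) :
    blockSum X a r ω = blockSum X 1 r ω := by
  symm
  refine sum_subset (Icc_subset_Icc_left ha) fun x hx hx' => hX.zero x ?_ ω
  simp only [mem_Icc] at hx hx'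
  omega

theorem blockSum_one_add {r s : ℤ} (h2 : r ≤ s) (ω : Ω) :
    blockSum X 1 s ω = blockSum X 1 r ω + blockSum X (r + 1) s ω := by
  rw [← hX.blockSum_eq_of_le_one (min_le_left 1 (r + 1)) s,
    ← hX.blockSum_eq_of_le_one (min_le_left 1 (r + 1)) r]
  exact blockSum_add X (min_le_right _ _) h2 ω

theorem measurable_blockSum (a : ℤ) {b : ℤ} (hb : b ≤ n) : Measurable (blockSum X a b) :=
  Finset.measurable_sum _ fun i hi => hX.meas i ((mem_Icc.1 hi).2.trans hb)

theorem blockSum_nonneg (a : ℤ) {b : ℤ} (hb : b ≤ n) (ω : Ω) : 0 ≤ blockSum X a b ω :=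
  sum_nonneg fun i hi => hX.nonneg i ((mem_Icc.1 hi).2.trans hb) ω

theorem memLp_blockSum (a : ℤ) {b : ℤ} (hb : b ≤ n) :
    MemLp (fun ω => (blockSum X a b ω : ℝ)) 2 μ := by
  have := memLp_finsetSum (Icc a b) (f := fun i ω => (X i ω : ℝ)) (p := 2) (μ := μ)
    fun i hi => hX.memLp i ((mem_Icc.1 hi).2.trans hb)
  simpa [blockSum] using this

theorem integrable {i : ℤ} (hi : i ≤ n) : Integrable (fun ω => (X i ω : ℝ)) μ :=
  (hX.memLp i hi).integrable one_le_two

theorem integrable_mul {i j : ℤ} (hi : i ≤ n) (hj : j ≤ n) :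
    Integrable (fun ω => (X i ω : ℝ) * X j ω) μ :=
  (hX.memLp i hi).integrable_mul (hX.memLp j hj)

theorem probNonzero_eq_zero {i : ℤ} (hi : i < 1) : probNonzero μ (X i) = 0 := by
  simp [probNonzero, hX.zero i hi]

/-- Block sums of the past are independent of triples (block sum, block sum, variable) of the
future. -/
theorem indepFun_blockSum {c a b a' b' a'' b'' i : ℤ} (hb : b ≤ c) (hbn : b ≤ n)
    (ha' : c + k ≤ a') (hb' : b' ≤ n) (ha'' : c + k ≤ a'') (hb'' : b'' ≤ n)
    (hi : c + k ≤ i) (hin : i ≤ n) :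
    IndepFun (blockSum X a b) (fun ω => (blockSum X a' b' ω, blockSum X a'' b'' ω, X i ω)) μ := by
  have h := (hX.indep c).comp (φ := fun f : ℤ → ℤ => ∑ t ∈ Icc a b, f t)
    (ψ := fun f : ℤ → ℤ => (∑ t ∈ Icc a' b', f t, ∑ t ∈ Icc a'' b'', f t, f i))
    (by fun_prop) (by fun_prop)
  convert! h using 1
  · ext ω
    refine sum_congr rfl fun t ht => ?_
    rw [mem_Icc] at ht
    exact (if_pos ⟨by omega, by omega⟩).symm
  · ext ω
    · change ∑ t ∈ Icc a' b', X t ω =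
        ∑ t ∈ Icc a' b', (if c + k ≤ t ∧ t ≤ n then X t ω else 0)
      refine sum_congr rfl fun t ht => ?_
      rw [mem_Icc] at ht
      exact (if_pos ⟨by omega, by omega⟩).symm
    · change ∑ t ∈ Icc a'' b'', X t ω =
        ∑ t ∈ Icc a'' b'', (if c + k ≤ t ∧ t ≤ n then X t ω else 0)
      refine sum_congr rfl fun t ht => ?_
      rw [mem_Icc] at ht
      exact (if_pos ⟨by omega, by omega⟩).symm
    · simp [hi, hin]

theorem measurable_triple (a' a'' : ℤ) {b' b'' i : ℤ} (hb' : b' ≤ n) (hb'' : b'' ≤ n)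
    (hin : i ≤ n) :
    Measurable fun ω => (blockSum X a' b' ω, blockSum X a'' b'' ω, X i ω) :=
  (hX.measurable_blockSum a' hb').prodMk
    ((hX.measurable_blockSum a'' hb'').prodMk (hX.meas i hin))

theorem probNonzero_blockSum_le (a b : ℤ) :
    probNonzero μ (blockSum X a b) ≤ ∑ j ∈ Icc a b, probNonzero μ (X j) := by
  refine le_trans ?_ (measureReal_biUnion_finset_le (μ := μ) (Icc a b) fun j => {ω | X j ω ≠ 0})
  refine measureReal_mono (fun ω hω => ?_) (measure_ne_top _ _)
  simp only [Set.mem_iUnion, Set.mem_ofPred_eq, exists_prop]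
  by_contra! hcon
  exact hω (sum_eq_zero hcon)

theorem measureReal_blockSum_inter_le (a b i : ℤ) :
    μ.real {ω | blockSum X a b ω ≠ 0 ∧ X i ω ≠ 0} ≤
      ∑ j ∈ Icc a b, μ.real {ω | X j ω ≠ 0 ∧ X i ω ≠ 0} := by
  refine le_trans ?_
    (measureReal_biUnion_finset_le (μ := μ) (Icc a b) fun j => {ω | X j ω ≠ 0 ∧ X i ω ≠ 0})
  refine measureReal_mono (fun ω hω => ?_) (measure_ne_top _ _)
  simp only [Set.mem_iUnion, Set.mem_ofPred_eq, exists_prop]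
  by_contra! hcon
  refine hω.1 (sum_eq_zero fun j hj => ?_)
  by_contra hne
  exact hω.2 (hcon j hj hne)

omit hX in
/-- The probability that `X_i` and a neighbour of `X_i` on the left are both non-zero, summed over
the neighbours, plus its value under independence. -/
def _root_.localWeight (μ : Measure Ω) (X : ℤ → Ω → ℤ) (k : ℕ) (i : ℤ) : ℝ :=
  ∑ j ∈ Icc (i - k + 1) (i - 1),
    (μ.real {ω | X j ω ≠ 0 ∧ X i ω ≠ 0} + probNonzero μ (X i) * probNonzero μ (X j))

omit hX in
/-- The local interaction `(χ(B) - 1) (χ(X_i) - E χ(X_i))`, `B` the sum of the neighbours of `X_i`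
on the left. -/
def _root_.BddChar.interaction (χ : BddChar 𝔸) (μ : Measure Ω) (X : ℤ → Ω → ℤ) (k : ℕ) (i : ℤ)
    (ω : Ω) : 𝔸 :=
  (χ (blockSum X (i - k + 1) (i - 1) ω) - 1) * (χ (X i ω) - χ.mean μ (X i))

variable (χ : BddChar 𝔸)

omit hX in
theorem _root_.BddChar.norm_interaction_le (i : ℤ) (ω : Ω) : ‖χ.interaction μ X k i ω‖ ≤ 4 := by
  refine (norm_mul_le _ _).trans ?_
  have h1 := χ.norm_sub_one_le_two (blockSum X (i - k + 1) (i - 1) ω)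
  have h2 : ‖χ (X i ω) - χ.mean μ (X i)‖ ≤ 2 := by
    refine (norm_sub_le _ _).trans ?_
    linarith [χ.norm_le (X i ω), χ.norm_mean_le (μ := μ) (X i)]
  nlinarith [norm_nonneg (χ (X i ω) - χ.mean μ (X i))]

theorem stronglyMeasurable_interaction {i : ℤ} (hi : i ≤ n) :
    StronglyMeasurable (χ.interaction μ X k i) :=
  ((stronglyMeasurable_comp_discrete (hX.measurable_blockSum _ (by omega)) _).sub
    stronglyMeasurable_const).mul
    ((stronglyMeasurable_comp_discrete (hX.meas i hi) _).sub stronglyMeasurable_const)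

theorem integrable_interaction {i : ℤ} (hi : i ≤ n) : Integrable (χ.interaction μ X k i) μ :=
  Integrable.of_bound (hX.stronglyMeasurable_interaction χ hi).aestronglyMeasurable 4
    (Filter.Eventually.of_forall (χ.norm_interaction_le i))

/-- With `B` the sum of the left neighbours, the interaction vanishes where `B = 0`. Elsewhere its
first factor is at most `2` and its second at most `2 · 1{X_i ≠ 0} + 2 p_i`; a union bound over the
neighbours finishes. -/
theorem integral_norm_interaction_le {i : ℤ} (hi : i ≤ n) :
    ∫ ω, ‖χ.interaction μ X k i ω‖ ∂μ ≤ 4 * localWeight μ X k i := by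
  set B := blockSum X (i - k + 1) (i - 1) with hB
  set p := probNonzero μ (X i) with hp
  have hp0 : 0 ≤ p := measureReal_nonneg
  have hBm : Measurable B := hX.measurable_blockSum _ (by omega)
  have hmE : MeasurableSet {ω | B ω ≠ 0 ∧ X i ω ≠ 0} :=
    (measurableSet_ne_zero hBm).inter (measurableSet_ne_zero (hX.meas i hi))
  have hint1 : Integrable ({ω | B ω ≠ 0 ∧ X i ω ≠ 0}.indicator (1 : Ω → ℝ)) μ :=
    (integrable_const (1 : ℝ)).indicator hmE
  have hint2 : Integrable ({ω | B ω ≠ 0}.indicator (1 : Ω → ℝ)) μ :=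
    (integrable_const (1 : ℝ)).indicator (measurableSet_ne_zero hBm)
  have h1 : ∫ ω, ‖χ.interaction μ X k i ω‖ ∂μ ≤
      ∫ ω, (4 * {ω | B ω ≠ 0 ∧ X i ω ≠ 0}.indicator (1 : Ω → ℝ) ω
        + 4 * p * {ω | B ω ≠ 0}.indicator (1 : Ω → ℝ) ω) ∂μ := by
    refine integral_mono (hX.integrable_interaction χ hi).norm
      ((hint1.const_mul _).add (hint2.const_mul _)) fun ω => ?_
    simp only [BddChar.interaction]
    refine (norm_mul_le _ _).trans ?_
    by_cases hb : B ω = 0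
    · simp [← hB, hb, χ.map_zero]
    · have h2 := χ.norm_sub_one_le_two (B ω)
      have h3 : ‖χ (X i ω) - χ.mean μ (X i)‖ ≤ ‖χ (X i ω) - 1‖ + 2 * p := by
        rw [show χ (X i ω) - χ.mean μ (X i) = (χ (X i ω) - 1) - (χ.mean μ (X i) - 1) by ring]
        exact (norm_sub_le _ _).trans
          (add_le_add_right (χ.norm_mean_sub_one_le (hX.meas i hi)) _)
      by_cases hx : X i ω = 0
      · simp only [hx, χ.map_zero, sub_self, norm_zero, zero_add] at h3
        simp only [hx, χ.map_zero]
        rw [Set.indicator_of_notMem (by simp [hx]),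
          Set.indicator_of_mem (show ω ∈ {ω | B ω ≠ 0} from hb)]
        simp only [Pi.one_apply]
        nlinarith [norm_nonneg (1 - χ.mean μ (X i))]
      · rw [Set.indicator_of_mem (show ω ∈ {ω | B ω ≠ 0 ∧ X i ω ≠ 0} from ⟨hb, hx⟩),
          Set.indicator_of_mem (show ω ∈ {ω | B ω ≠ 0} from hb)]
        have h4 := χ.norm_sub_one_le_two (X i ω)
        simp only [Pi.one_apply]
        nlinarith [norm_nonneg (χ (X i ω) - χ.mean μ (X i))]
  refine h1.trans ?_
  rw [integral_add (hint1.const_mul _) (hint2.const_mul _), integral_const_mul,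
    integral_const_mul, integral_indicator_one hmE,
    integral_indicator_one (measurableSet_ne_zero hBm), localWeight, sum_add_distrib, ← mul_sum]
  have h5 := hX.measureReal_blockSum_inter_le (i - k + 1) (i - 1) i
  have h6 := hX.probNonzero_blockSum_le (i - k + 1) (i - 1)
  have h7 := mul_le_mul_of_nonneg_left h6 hp0
  change 4 * μ.real {ω | B ω ≠ 0 ∧ X i ω ≠ 0} + 4 * p * probNonzero μ B ≤ _
  linarith

/-- Decoupling of `X_i` from a block sum that contains its neighbours on the left. -/
theorem mean_sub_mean_mul_eq {a i : ℤ} (ha : a ≤ i - k + 1) (hk : 1 ≤ k) (hi : i ≤ n) :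
    χ.mean μ (blockSum X a i) - χ.mean μ (blockSum X a (i - 1)) * χ.mean μ (X i) =
      ∫ ω, χ (blockSum X a (i - k) ω) * χ.interaction μ X k i ω ∂μ := by
  have hQ := hX.measurable_blockSum a (b := i - k) (by omega)
  have hQB := hX.measurable_blockSum a (b := i - 1) (by omega)
  have hI := hX.measurable_blockSum a hi
  have hXi := hX.meas i hi
  have hind : IndepFun (blockSum X a (i - k)) (X i) μ := by
    have := hX.indepFun_blockSum (c := i - k) (a := a) (b := i - k) (a' := i) (b' := i)
      (a'' := i) (b'' := i) (i := i) (by omega) (by omega) (by omega) hi (by omega) hi (by omega) hi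
    exact this.comp measurable_id (measurable_snd.comp measurable_snd)
  -- `X_i` is independent of the block ending at `i - k`, so its centred transform integrates to
  -- zero against it. Subtracting this zero turns `χ(B)` into `χ(B) - 1`.
  have h0 : ∫ ω, χ (blockSum X a (i - k) ω) * (χ (X i ω) - χ.mean μ (X i)) ∂μ = 0 := by
    rw [integral_mul_comp_of_indepFun (b := fun z => χ z - χ.mean μ (X i)) hind hQ hXi χ.norm_le
      (D := 2) fun z => (norm_sub_le _ _).trans
        (by linarith [χ.norm_le z, χ.norm_mean_le (μ := μ) (X i)])]
    rw [integral_sub (χ.integrable_comp hXi) (integrable_const _)]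
    simp [BddChar.mean]
  have hint : Integrable (fun ω => χ (blockSum X a (i - k) ω) * (χ (X i ω) - χ.mean μ (X i))) μ :=
    Integrable.of_bound (C := 2) ((stronglyMeasurable_comp_discrete hQ _).mul
      ((stronglyMeasurable_comp_discrete hXi _).sub stronglyMeasurable_const)).aestronglyMeasurable
      (Filter.Eventually.of_forall fun ω => by
        refine (norm_mul_le _ _).trans ?_
        have h1 := χ.norm_le (blockSum X a (i - k) ω)
        have h2 : ‖χ (X i ω) - χ.mean μ (X i)‖ ≤ 2 := (norm_sub_le _ _).trans
          (by linarith [χ.norm_le (X i ω), χ.norm_mean_le (μ := μ) (X i)])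
        nlinarith [norm_nonneg (χ (X i ω) - χ.mean μ (X i))])
  have hmul : Integrable (fun ω => χ (blockSum X a (i - 1) ω) * χ.mean μ (X i)) μ :=
    (χ.integrable_comp hQB).mul_const _
  rw [BddChar.mean, BddChar.mean, ← integral_mul_const_of_integrable (χ.integrable_comp hQB),
    ← integral_sub (χ.integrable_comp hI) hmul, ← sub_zero (∫ ω, _ ∂μ), ← h0,
    ← integral_sub (f := fun ω => _ - _) ((χ.integrable_comp hI).sub hmul) hint]
  congr 1
  ext ω
  have e1 := blockSum_succ X (a := a) (i := i) (by omega) ω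
  have e2 := blockSum_add X (a := a) (r := i - k) (s := i - 1) (by omega) (by omega) ω
  rw [BddChar.interaction, e1, χ.map_add, e2, χ.map_add]
  ring

theorem norm_mean_sub_mean_mul_le {a i : ℤ} (ha : a ≤ i - k + 1) (hk : 1 ≤ k) (hi : i ≤ n) :
    ‖χ.mean μ (blockSum X a i) - χ.mean μ (blockSum X a (i - 1)) * χ.mean μ (X i)‖ ≤
      4 * localWeight μ X k i := by
  rw [hX.mean_sub_mean_mul_eq χ ha hk hi]
  refine (norm_integral_le_of_norm_le (hX.integrable_interaction χ hi).norm
    (Filter.Eventually.of_forall fun ω => ?_)).trans (hX.integral_norm_interaction_le χ hi)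
  refine (norm_mul_le _ _).trans ?_
  exact mul_le_of_le_one_left (norm_nonneg _) (χ.norm_le _)

end LocallyDependent

end LocalDependence

/-! ### Replacement errors, telescoping and the general norm bound -/

section CompoundPoissonBound

open NormedSpace Finset

variable {𝔸 : Type*} [NormedCommRing 𝔸] [NormedAlgebra ℝ 𝔸] [CompleteSpace 𝔸] [NormOneClass 𝔸]
variable {Ω : Type*} [MeasurableSpace Ω] {μ : Measure Ω} [IsProbabilityMeasure μ]

/-- The total probability `p_{i-3k+3} + ⋯ + p_{i-2k+1}` of the block separating the distant past of
`X_i` from its neighbourhood. -/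
def gapWeight (μ : Measure Ω) (X : ℤ → Ω → ℤ) (k : ℕ) (i : ℤ) : ℝ :=
  ∑ j ∈ Icc (i - 3 * k + 3) (i - 2 * k + 1), probNonzero μ (X j)

/-- The effect, seen through `χ`, of replacing `X_i` by a compound Poisson variable in the sum
`X_a + ⋯ + X_i`. -/
def BddChar.replacement (χ : BddChar 𝔸) (μ : Measure Ω) (X : ℤ → Ω → ℤ) (a i : ℤ) : 𝔸 :=
  χ.mean μ (blockSum X a i) - χ.mean μ (blockSum X a (i - 1)) * exp (χ.mean μ (X i) - 1)

namespace LocallyDependent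

variable {X : ℤ → Ω → ℤ} {k n : ℕ} (hX : LocallyDependent μ X k n) (χ : BddChar 𝔸)
include hX

/-- Decoupling of the distant past from the neighbourhood of `X_i`. -/
theorem norm_integral_sub_mean_mul_le {i a' b' a'' b'' : ℤ} (hk : 1 ≤ k) (hi : i ≤ n)
    (ha' : i - 2 * k + 2 ≤ a') (hb' : b' ≤ n) (ha'' : i - 2 * k + 2 ≤ a'') (hb'' : b'' ≤ n)
    {b : ℤ × ℤ × ℤ → 𝔸} {C : ℝ} (hC : ∀ x, ‖b x‖ ≤ C) :
    ‖∫ ω, χ (blockSum X 1 (i - 2 * k + 1) ω) *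
          b (blockSum X a' b' ω, blockSum X a'' b'' ω, X i ω) ∂μ
        - χ.mean μ (blockSum X 1 (i - 3 * k + 2)) *
          ∫ ω, b (blockSum X a' b' ω, blockSum X a'' b'' ω, X i ω) ∂μ‖ ≤
      2 * ∫ ω, (if blockSum X (i - 3 * k + 3) (i - 2 * k + 1) ω ≠ 0 then (1 : ℝ) else 0) *
        ‖b (blockSum X a' b' ω, blockSum X a'' b'' ω, X i ω)‖ ∂μ := by
  have hη := hX.measurable_triple a' a'' hb' hb'' hi
  have hR := hX.measurable_blockSum 1 (b := i - 3 * k + 2) (by omega)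
  have hM := hX.measurable_blockSum (i - 3 * k + 3) (b := i - 2 * k + 1) (by omega)
  have hS := hX.measurable_blockSum 1 (b := i - 2 * k + 1) (by omega)
  have hind := hX.indepFun_blockSum (c := i - 3 * k + 2) (a := 1) (b := i - 3 * k + 2) (a' := a')
    (b' := b') (a'' := a'') (b'' := b'') (i := i) le_rfl (by omega) (by omega) hb' (by omega) hb''
    (by omega) hi
  have hmono : ∀ {Y : Ω → ℤ}, Measurable Y → Integrable (fun ω => χ (Y ω) *
      b (blockSum X a' b' ω, blockSum X a'' b'' ω, X i ω)) μ := fun {Y} hY =>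
    Integrable.of_bound (C := C) ((stronglyMeasurable_comp_discrete hY _).mul
      (stronglyMeasurable_comp_discrete hη b)).aestronglyMeasurable
      (Filter.Eventually.of_forall fun ω => (norm_mul_le _ _).trans
        ((mul_le_of_le_one_left (norm_nonneg _) (χ.norm_le _)).trans (hC _)))
  have hW : Integrable (fun ω => b (blockSum X a' b' ω, blockSum X a'' b'' ω, X i ω)) μ :=
    integrable_comp_discrete hη hC
  have hg : Integrable (fun ω =>
      (if blockSum X (i - 3 * k + 3) (i - 2 * k + 1) ω ≠ 0 then (1 : ℝ) else 0) *
        ‖b (blockSum X a' b' ω, blockSum X a'' b'' ω, X i ω)‖) μ :=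
    hW.norm.bdd_mul (c := 1)
      (BddChar.integrable_ite_ne_zero hM).aestronglyMeasurable
      (Filter.Eventually.of_forall fun ω => by split_ifs <;> simp)
  -- Independence merges the product into one expectation, so the two integrands differ only by the
  -- gap block.
  rw [BddChar.mean, ← integral_mul_comp_of_indepFun hind hR hη χ.norm_le hC,
    ← integral_sub (hmono hS) (hmono hR), ← integral_const_mul]
  refine norm_integral_le_of_norm_le (hg.const_mul 2) (Filter.Eventually.of_forall fun ω => ?_)
  have e := hX.blockSum_one_add (r := i - 3 * k + 2) (s := i - 2 * k + 1) (by omega) ω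
  rw [show i - 3 * (k : ℤ) + 2 + 1 = i - 3 * k + 3 by ring] at e
  rw [e, χ.map_add, ← sub_mul]
  refine (norm_mul_le _ _).trans ?_
  rw [← mul_assoc]
  refine mul_le_mul_of_nonneg_right ?_ (norm_nonneg _)
  rw [show ∀ x y : 𝔸, x * y - x = x * (y - 1) from fun x y => by ring]
  refine (norm_mul_le _ _).trans ((mul_le_of_le_one_left (norm_nonneg _) (χ.norm_le _)).trans ?_)
  -- `χ(gap) - 1` vanishes when the gap sum is zero and has norm at most `2` otherwise.
  split_ifs with h
  · simpa using χ.norm_sub_one_le_two _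
  · push Not at h
    simp [h, χ.map_zero]

theorem probNonzero_gap_le (i : ℤ) :
    probNonzero μ (blockSum X (i - 3 * k + 3) (i - 2 * k + 1)) ≤ gapWeight μ X k i :=
  hX.probNonzero_blockSum_le _ _

/-- The block from `i - 2k + 2` to `i - k` may depend on the gap, so it is discarded through `‖χ‖ ≤
1`. The interaction involves only indices from `i - k + 1` on, at distance `k` from the gap, so the
probability of a non-zero gap factors out. -/
theorem norm_integral_interaction_sub_le {i : ℤ} (hk : 1 ≤ k) (hi : i ≤ n) :
    ‖∫ ω, χ (blockSum X 1 (i - k) ω) * χ.interaction μ X k i ω ∂μ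
        - χ.mean μ (blockSum X 1 (i - 3 * k + 2)) *
          ∫ ω, χ (blockSum X (i - 2 * k + 2) (i - k) ω) * χ.interaction μ X k i ω ∂μ‖ ≤
      2 * gapWeight μ X k i * (4 * localWeight μ X k i) := by
  set v : ℤ × ℤ → 𝔸 := fun x => (χ x.1 - 1) * (χ x.2 - χ.mean μ (X i)) with hv
  have hv4 : ∀ x, ‖v x‖ ≤ 4 := fun x => by
    refine (norm_mul_le _ _).trans ?_
    have h2 : ‖χ x.2 - χ.mean μ (X i)‖ ≤ 2 := by
      refine (norm_sub_le _ _).trans ?_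
      linarith [χ.norm_le x.2, χ.norm_mean_le (μ := μ) (X i)]
    nlinarith [norm_nonneg (χ x.2 - χ.mean μ (X i)), χ.norm_sub_one_le_two x.1]
  have hb : ∀ x : ℤ × ℤ × ℤ, ‖χ x.1 * v x.2‖ ≤ 4 := fun x =>
    (norm_mul_le _ _).trans
      ((mul_le_of_le_one_left (norm_nonneg _) (χ.norm_le _)).trans (hv4 _))
  have h := hX.norm_integral_sub_mean_mul_le χ (i := i) (a' := i - 2 * k + 2) (b' := i - k)
    (a'' := i - k + 1) (b'' := i - 1) hk hi le_rfl (by omega) (by omega) (by omega)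
    (b := fun x => χ x.1 * v x.2) hb
  have e : ∀ ω, χ (blockSum X 1 (i - k) ω) = χ (blockSum X 1 (i - 2 * k + 1) ω) *
      χ (blockSum X (i - 2 * k + 2) (i - k) ω) := fun ω => by
    have e := hX.blockSum_one_add (r := i - 2 * k + 1) (s := i - k) (by omega) ω
    rw [show i - 2 * (k : ℤ) + 1 + 1 = i - 2 * k + 2 by ring] at e
    rw [e, χ.map_add]
  simp only [e, mul_assoc]
  refine h.trans ?_
  have hM := hX.measurable_blockSum (i - 3 * k + 3) (b := i - 2 * k + 1) (by omega)
  have hB := hX.measurable_blockSum (i - k + 1) (b := i - 1) (by omega)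
  have hind : IndepFun (blockSum X (i - 3 * k + 3) (i - 2 * k + 1))
      (fun ω => (blockSum X (i - k + 1) (i - 1) ω, X i ω)) μ := by
    have := hX.indepFun_blockSum (c := i - 2 * k + 1) (a := i - 3 * k + 3) (b := i - 2 * k + 1)
      (a' := i - k + 1) (b' := i - 1) (a'' := i - k + 1) (b'' := i - 1) (i := i)
      le_rfl (by omega) (by omega) (by omega) (by omega) (by omega) (by omega) hi
    exact this.comp measurable_id measurable_snd
  have hpair : Measurable fun ω => (blockSum X (i - k + 1) (i - 1) ω, X i ω) :=
    hB.prodMk (hX.meas i hi)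
  have hgint : Integrable (fun ω =>
      (if blockSum X (i - 3 * k + 3) (i - 2 * k + 1) ω ≠ 0 then (1 : ℝ) else 0) *
        ‖χ.interaction μ X k i ω‖) μ :=
    (hX.integrable_interaction χ hi).norm.bdd_mul (c := 1)
      (BddChar.integrable_ite_ne_zero hM).aestronglyMeasurable
      (Filter.Eventually.of_forall fun ω => by split_ifs <;> simp)
  calc 2 * ∫ ω, (if blockSum X (i - 3 * k + 3) (i - 2 * k + 1) ω ≠ 0 then (1 : ℝ) else 0) *
        ‖χ (blockSum X (i - 2 * k + 2) (i - k) ω) *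
          v (blockSum X (i - k + 1) (i - 1) ω, X i ω)‖ ∂μ
      ≤ 2 * ∫ ω, (if blockSum X (i - 3 * k + 3) (i - 2 * k + 1) ω ≠ 0 then (1 : ℝ) else 0) *
        ‖χ.interaction μ X k i ω‖ ∂μ := by
        refine mul_le_mul_of_nonneg_left ?_ zero_le_two
        refine integral_mono_of_nonneg (Filter.Eventually.of_forall fun ω => by
          dsimp only [Pi.zero_apply]; split_ifs <;> simp) hgint
          (Filter.Eventually.of_forall fun ω => ?_)
        refine mul_le_mul_of_nonneg_left ?_ (by split_ifs <;> simp)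
        exact (norm_mul_le _ _).trans (mul_le_of_le_one_left (norm_nonneg _) (χ.norm_le _))
    _ = 2 * (probNonzero μ (blockSum X (i - 3 * k + 3) (i - 2 * k + 1)) *
          ∫ ω, ‖χ.interaction μ X k i ω‖ ∂μ) := by
        rw [← integral_indicator_ne_zero hM]
        congr 1
        exact integral_mul_comp_of_indepFun (a := fun z : ℤ => if z ≠ 0 then (1 : ℝ) else 0)
          (b := fun x => ‖v x‖) (C := 1) (D := 4) hind hM hpair
          (fun z => by split_ifs <;> simp) (fun x => by simpa using hv4 x)
    _ ≤ 2 * (gapWeight μ X k i * (4 * localWeight μ X k i)) := by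
        refine mul_le_mul_of_nonneg_left ?_ zero_le_two
        exact mul_le_mul (hX.probNonzero_gap_le i) (hX.integral_norm_interaction_le χ hi)
          (integral_nonneg fun _ => norm_nonneg _)
          (sum_nonneg fun _ _ => measureReal_nonneg)
    _ = _ := by ring

theorem norm_mean_blockSum_sub_le {i : ℤ} (hk : 1 ≤ k) (hi : i ≤ n) :
    ‖χ.mean μ (blockSum X 1 (i - 1)) - χ.mean μ (blockSum X 1 (i - 3 * k + 2)) *
        χ.mean μ (blockSum X (i - 2 * k + 2) (i - 1))‖ ≤ 2 * gapWeight μ X k i := by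
  have h := hX.norm_integral_sub_mean_mul_le χ (i := i) (a' := i - 2 * k + 2) (b' := i - 1)
    (a'' := i - 2 * k + 2) (b'' := i - 1) hk hi le_rfl (by omega) (by omega) (by omega)
    (b := fun x => χ x.1) fun x => χ.norm_le _
  have e : ∀ ω, χ (blockSum X 1 (i - 1) ω) = χ (blockSum X 1 (i - 2 * k + 1) ω) *
      χ (blockSum X (i - 2 * k + 2) (i - 1) ω) := fun ω => by
    have e := hX.blockSum_one_add (r := i - 2 * k + 1) (s := i - 1) (by omega) ω
    rw [show i - 2 * (k : ℤ) + 1 + 1 = i - 2 * k + 2 by ring] at e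
    rw [e, χ.map_add]
  have hM := hX.measurable_blockSum (i - 3 * k + 3) (b := i - 2 * k + 1) (by omega)
  rw [BddChar.mean]
  simp only [e]
  refine h.trans (mul_le_mul_of_nonneg_left (le_trans ?_ (hX.probNonzero_gap_le i)) zero_le_two)
  rw [← integral_indicator_ne_zero hM]
  refine integral_mono_of_nonneg (Filter.Eventually.of_forall fun ω => by
    dsimp only [Pi.zero_apply]; split_ifs <;> simp) (BddChar.integrable_ite_ne_zero hM)
    (Filter.Eventually.of_forall fun ω => ?_)
  exact mul_le_of_le_one_right (by split_ifs <;> simp) (χ.norm_le _)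

/-- Separates the error due to local dependence from the error of replacing an independent copy of
`X_i` by a compound Poisson variable. -/
theorem replacement_eq {a i : ℤ} (ha : a ≤ i - k + 1) (hk : 1 ≤ k) (hi : i ≤ n) :
    χ.replacement μ X a i = ∫ ω, χ (blockSum X a (i - k) ω) * χ.interaction μ X k i ω ∂μ
      + χ.mean μ (blockSum X a (i - 1)) *
        (χ.mean μ (X i) - exp (χ.mean μ (X i) - 1)) := by
  rw [← hX.mean_sub_mean_mul_eq χ ha hk hi, BddChar.replacement]
  ring

theorem replacement_one_eq {a i : ℤ} (ha : a ≤ 1) :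
    χ.replacement μ X a i = χ.replacement μ X 1 i := by
  rw [BddChar.replacement, BddChar.replacement, funext (hX.blockSum_eq_of_le_one ha i),
    funext (hX.blockSum_eq_of_le_one ha (i - 1))]

theorem norm_replacement_le {a i : ℤ} (ha : a ≤ i - k + 1) (hk : 1 ≤ k) (hi : i ≤ n) :
    ‖χ.replacement μ X a i‖ ≤ 4 * localWeight μ X k i + 2 * probNonzero μ (X i) ^ 2 := by
  rw [hX.replacement_eq χ ha hk hi, ← hX.mean_sub_mean_mul_eq χ ha hk hi]
  refine (norm_add_le _ _).trans (add_le_add (hX.norm_mean_sub_mean_mul_le χ ha hk hi) ?_)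
  refine (norm_mul_le _ _).trans ((mul_le_of_le_one_left (norm_nonneg _)
    (χ.norm_mean_le _)).trans (χ.norm_mean_sub_exp_le (hX.meas i hi)))

/-- Up to a product of two small quantities, the replacement error factorizes into the distant past
and a local term. -/
theorem norm_replacement_sub_le {i : ℤ} (hk : 1 ≤ k) (hi : i ≤ n) :
    ‖χ.replacement μ X 1 i - χ.mean μ (blockSum X 1 (i - 3 * k + 2)) *
        χ.replacement μ X (i - 2 * k + 2) i‖ ≤
      2 * gapWeight μ X k i * (4 * localWeight μ X k i + 2 * probNonzero μ (X i) ^ 2) := by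
  -- For `i < k` the start `1` lies inside the neighbourhood of `X_i`; it is lowered so that the
  -- decoupling formula applies.
  rw [← hX.replacement_one_eq χ (min_le_left 1 (i - k + 1)),
    hX.replacement_eq χ (min_le_right 1 (i - k + 1)) hk hi,
    hX.replacement_eq χ (a := i - 2 * k + 2) (by omega) hk hi,
    funext (hX.blockSum_eq_of_le_one (min_le_left 1 (i - k + 1)) (i - k)),
    funext (hX.blockSum_eq_of_le_one (min_le_left 1 (i - k + 1)) (i - 1))]
  have h1 := hX.norm_integral_interaction_sub_le χ hk hi
  have h2 := hX.norm_mean_blockSum_sub_le χ hk hi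
  have h3 := χ.norm_mean_sub_exp_le (μ := μ) (hX.meas i hi)
  have h4 : ‖(χ.mean μ (blockSum X 1 (i - 1)) - χ.mean μ (blockSum X 1 (i - 3 * k + 2)) *
      χ.mean μ (blockSum X (i - 2 * k + 2) (i - 1))) *
      (χ.mean μ (X i) - exp (χ.mean μ (X i) - 1))‖ ≤
      2 * gapWeight μ X k i * (2 * probNonzero μ (X i) ^ 2) :=
    (norm_mul_le _ _).trans (mul_le_mul h2 h3 (norm_nonneg _) ((norm_nonneg _).trans h2))
  have h5 := (norm_add_le _ _).trans (add_le_add h1 h4)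
  rw [← mul_add] at h5
  refine le_trans (le_of_eq ?_) h5
  congr 1
  ring

/-- Lindeberg telescoping. -/
theorem mean_sub_exp_eq_sum (m : ℕ) :
    χ.mean μ (blockSum X 1 m) - exp (∑ l ∈ Icc (1 : ℤ) m, (χ.mean μ (X l) - 1)) =
      ∑ i ∈ Icc (1 : ℤ) m, χ.replacement μ X 1 i *
        exp (∑ l ∈ Icc (i + 1) m, (χ.mean μ (X l) - 1)) := by
  induction m with
  | zero => simp [BddChar.mean, blockSum, χ.map_zero, exp_zero]
  | succ m ih =>
    have hIcc : ∀ a : ℤ, a ≤ m + 1 → Icc a ((m + 1 : ℕ) : ℤ) = insert ((m : ℤ) + 1) (Icc a m) := by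
      intro a ha
      ext x
      simp only [mem_Icc, mem_insert]
      push_cast
      omega
    have hnot : ∀ a : ℤ, (m : ℤ) + 1 ∉ Icc a (m : ℤ) := fun a => by simp
    rw [hIcc 1 (by omega), sum_insert (hnot 1), sum_insert (hnot 1), banach_exp_add]
    have hlast : Icc ((m : ℤ) + 1 + 1) ((m + 1 : ℕ) : ℤ) = ∅ := by
      rw [Icc_eq_empty]; push_cast; omega
    rw [hlast, sum_empty, exp_zero, mul_one]
    have hsum : ∑ i ∈ Icc (1 : ℤ) m, χ.replacement μ X 1 i *
          exp (∑ l ∈ Icc (i + 1) ((m + 1 : ℕ) : ℤ), (χ.mean μ (X l) - 1)) =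
        (∑ i ∈ Icc (1 : ℤ) m, χ.replacement μ X 1 i *
          exp (∑ l ∈ Icc (i + 1) (m : ℤ), (χ.mean μ (X l) - 1))) *
          exp (χ.mean μ (X (m + 1)) - 1) := by
      rw [sum_mul]
      refine sum_congr rfl fun i hi => ?_
      rw [mem_Icc] at hi
      rw [hIcc (i + 1) (by omega), sum_insert (hnot _), banach_exp_add]
      ring
    rw [hsum, ← ih, BddChar.replacement]
    push_cast
    rw [add_sub_cancel_right]
    ring

theorem norm_exp_sum_le (s : Finset ℤ) : ‖exp (∑ l ∈ s, (χ.mean μ (X l) - 1))‖ ≤ 1 := by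
  classical
  induction s using Finset.induction_on with
  | empty => simp [exp_zero]
  | insert a s ha ih =>
    rw [sum_insert ha, banach_exp_add]
    exact (norm_mul_le _ _).trans (mul_le_one₀ (χ.norm_exp_mean_sub_one_le _) (norm_nonneg _) ih)

/-- The unsmoothed estimate: after telescoping, the exponential factors are contractions and are
dropped. It serves the distant past, where smoothing is not needed. -/
theorem norm_mean_sub_exp_sum_le {a : ℤ → ℝ} {r : ℤ} (hr : r ≤ n)
    (ha : ∀ j : ℤ, 1 ≤ j → j ≤ n → ‖χ.replacement μ X 1 j‖ ≤ 4 * a j) :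
    ‖χ.mean μ (blockSum X 1 r) - exp (∑ l ∈ Icc 1 r, (χ.mean μ (X l) - 1))‖ ≤
      4 * ∑ j ∈ Icc 1 r, a j := by
  -- The application has `r = i - 3k + 2`, possibly negative; then both transforms are `1`.
  rcases lt_or_ge r 0 with h | h
  · have : Icc 1 r = ∅ := Icc_eq_empty (by omega)
    simp [this, BddChar.mean, blockSum, χ.map_zero, exp_zero]
  · obtain ⟨m, rfl⟩ := Int.eq_ofNat_of_zero_le h
    rw [hX.mean_sub_exp_eq_sum χ m, mul_sum]
    refine norm_sum_le_of_le _ fun j hj => ?_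
    rw [mem_Icc] at hj
    refine (norm_mul_le _ _).trans ?_
    exact (mul_le_of_le_one_right (norm_nonneg _) (hX.norm_exp_sum_le χ _)).trans
      (ha j hj.1 (by omega))

theorem sum_Icc_eq_sum_max {f : ℤ → ℝ} (hf : ∀ i < 1, f i = 0) (a b : ℤ) :
    ∑ j ∈ Icc a b, f j = ∑ j ∈ Icc (max 1 a) b, f j := by
  symm
  refine sum_subset (Icc_subset_Icc_left (le_max_right _ _)) fun x hx hx' => hf x ?_
  simp only [mem_Icc] at hx hx'
  omega

/-- Removing the jumps of a window from the compound Poisson approximation. -/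
theorem norm_mul_exp_window_le {m : ℝ} {i : ℤ} (hk : 1 ≤ k) (hi1 : 1 ≤ i) (hi : i ≤ n)
    (hm : ∑ j ∈ Icc (i - 3 * k + 3) i, probNonzero μ (X j) ≤ m) (A : 𝔸) :
    (1 - 2 * (1 - Real.exp (-m))) *
      ‖A * (exp (∑ l ∈ Icc 1 (i - 3 * k + 2), (χ.mean μ (X l) - 1)) *
        exp (∑ l ∈ Icc (i + 1) n, (χ.mean μ (X l) - 1)))‖ ≤
    ‖A * exp (∑ l ∈ Icc (1 : ℤ) n, (χ.mean μ (X l) - 1))‖ := by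
  -- The window is cut off at `1` to lie inside the index set of the full exponential; the cut terms
  -- have probability zero.
  set w := Icc (max 1 (i - 3 * k + 3)) i with hw
  have hsplit : Icc (1 : ℤ) n = (Icc 1 (i - 3 * k + 2) ∪ Icc (i + 1) n) ∪ w := by
    ext x; simp only [hw, mem_union, mem_Icc]; omega
  have hd1 : Disjoint (Icc 1 (i - 3 * (k : ℤ) + 2)) (Icc (i + 1) n) := by
    rw [disjoint_left]; intro x; simp only [mem_Icc]; omega
  have hd2 : Disjoint (Icc 1 (i - 3 * (k : ℤ) + 2) ∪ Icc (i + 1) n) w := by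
    rw [disjoint_left]; intro x; simp only [hw, mem_union, mem_Icc]; omega
  rw [hsplit, sum_union hd2, sum_union hd1, banach_exp_add, banach_exp_add]
  have hwsum : ∑ l ∈ w, (χ.mean μ (X l) - 1) =
      ∑ l ∈ w, χ.jumpMean μ (X l) - (∑ l ∈ w, probNonzero μ (X l)) • (1 : 𝔸) := by
    rw [sum_smul, ← sum_sub_distrib]
    refine sum_congr rfl fun l hl => χ.mean_sub_one_eq (hX.meas l ?_)
    rw [hw, mem_Icc] at hl
    omega
  have hr : ‖∑ l ∈ w, χ.jumpMean μ (X l)‖ ≤ ∑ l ∈ w, probNonzero μ (X l) :=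
    norm_sum_le_of_le _ fun l hl => χ.norm_jumpMean_le (hX.meas l (by
      rw [hw, mem_Icc] at hl
      omega))
  rw [hwsum, ← mul_assoc A (_ * _) (exp (_ - _))]
  refine le_trans ?_ (banach_norm_mul_exp_ge _ hr)
  refine mul_le_mul_of_nonneg_right ?_ (norm_nonneg _)
  have : Real.exp (-m) ≤ Real.exp (-∑ l ∈ w, probNonzero μ (X l)) := by
    refine Real.exp_le_exp.2 (neg_le_neg (le_trans (le_of_eq ?_) hm))
    exact (hX.sum_Icc_eq_sum_max (fun j hj => hX.probNonzero_eq_zero hj) _ _).symm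
  linarith

/-- The compound Poisson approximation bound in terms of bounds for the replacement errors. -/
theorem norm_mean_sub_exp_le {m : ℝ} {a β : ℤ → ℝ} (hk : 1 ≤ k)
    (hm : ∀ i : ℤ, 1 ≤ i → i ≤ n → ∑ j ∈ Icc (i - 3 * k + 3) i, probNonzero μ (X j) ≤ m)
    (hpos : 0 < 1 - 2 * (1 - Real.exp (-m)))
    (ha : ∀ i : ℤ, 1 ≤ i → i ≤ n → ‖χ.replacement μ X 1 i‖ ≤ 4 * a i)
    (hβ : ∀ i : ℤ, 1 ≤ i → i ≤ n → ∃ κ : 𝔸, ‖κ‖ ≤ β i ∧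
      χ.replacement μ X (i - 2 * k + 2) i = (χ 1 - 1) ^ 2 * κ) :
    ‖χ.mean μ (blockSum X 1 n) - exp (∑ l ∈ Icc (1 : ℤ) n, (χ.mean μ (X l) - 1))‖ ≤
      ∑ i ∈ Icc (1 : ℤ) n, (4 * ∑ j ∈ Icc 1 (i - 3 * k + 2), a j + 2 * gapWeight μ X k i) *
          (4 * localWeight μ X k i + 2 * probNonzero μ (X i) ^ 2)
      + ‖(χ 1 - 1) ^ 2 * exp (∑ l ∈ Icc (1 : ℤ) n, (χ.mean μ (X l) - 1))‖ /
          (1 - 2 * (1 - Real.exp (-m))) * ∑ i ∈ Icc (1 : ℤ) n, β i := by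
  rw [hX.mean_sub_exp_eq_sum χ n, mul_sum, ← sum_add_distrib]
  refine norm_sum_le_of_le _ fun i hi => ?_
  rw [mem_Icc] at hi
  obtain ⟨κ, hκ, hκeq⟩ := hβ i hi.1 hi.2
  set E₁ := exp (∑ l ∈ Icc 1 (i - 3 * (k : ℤ) + 2), (χ.mean μ (X l) - 1)) with hE₁
  set E₂ := exp (∑ l ∈ Icc (i + 1) (n : ℤ), (χ.mean μ (X l) - 1)) with hE₂
  set T := χ.replacement μ X (i - 2 * k + 2) i with hT
  set R := χ.mean μ (blockSum X 1 (i - 3 * k + 2)) with hR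
  have hE₂1 : ‖E₂‖ ≤ 1 := hX.norm_exp_sum_le χ _
  have h1 := hX.norm_replacement_sub_le χ hk hi.2
  have h2 : ‖R - E₁‖ ≤ 4 * ∑ j ∈ Icc 1 (i - 3 * (k : ℤ) + 2), a j :=
    hX.norm_mean_sub_exp_sum_le χ (by omega) ha
  have h3 : ‖T‖ ≤ 4 * localWeight μ X k i + 2 * probNonzero μ (X i) ^ 2 :=
    hX.norm_replacement_le χ (by omega) hk hi.2
  -- `E₁ * E₂` is the full exponential without the window; the window is restored here.
  have h4 : ‖(χ 1 - 1) ^ 2 * (E₁ * E₂)‖ ≤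
      ‖(χ 1 - 1) ^ 2 * exp (∑ l ∈ Icc (1 : ℤ) n, (χ.mean μ (X l) - 1))‖ /
          (1 - 2 * (1 - Real.exp (-m))) := by
    rw [le_div_iff₀ hpos, mul_comm]
    exact hX.norm_mul_exp_window_le χ hk hi.1 hi.2 (hm i hi.1 hi.2) _
  have h5 : ‖(R - E₁) * T‖ ≤ (4 * ∑ j ∈ Icc 1 (i - 3 * (k : ℤ) + 2), a j) *
      (4 * localWeight μ X k i + 2 * probNonzero μ (X i) ^ 2) :=
    (norm_mul_le _ _).trans (mul_le_mul h2 h3 (norm_nonneg _) ((norm_nonneg _).trans h2))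
  have h6 : ‖((χ.replacement μ X 1 i - R * T) + (R - E₁) * T) * E₂‖ ≤
      (4 * ∑ j ∈ Icc 1 (i - 3 * (k : ℤ) + 2), a j + 2 * gapWeight μ X k i) *
          (4 * localWeight μ X k i + 2 * probNonzero μ (X i) ^ 2) := by
    refine (norm_mul_le _ _).trans ((mul_le_of_le_one_right (norm_nonneg _) hE₂1).trans ?_)
    rw [add_mul, add_comm (_ * _)]
    exact (norm_add_le _ _).trans (add_le_add h1 h5)
  have h7 : ‖(χ 1 - 1) ^ 2 * (E₁ * E₂) * κ‖ ≤
      ‖(χ 1 - 1) ^ 2 * exp (∑ l ∈ Icc (1 : ℤ) n, (χ.mean μ (X l) - 1))‖ /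
          (1 - 2 * (1 - Real.exp (-m))) * β i :=
    (norm_mul_le _ _).trans (mul_le_mul h4 hκ (norm_nonneg _) ((norm_nonneg _).trans h4))
  -- With `R_i` the replacement error from `1`, `R_i = (R_i - R T) + (R - E₁) T + E₁ T`: the first
  -- two terms are products of small quantities, and only the last needs smoothing.
  refine le_trans (le_of_eq ?_) ((norm_add_le _ _).trans (add_le_add h6 h7))
  congr 1
  rw [show (χ 1 - 1) ^ 2 * (E₁ * E₂) * κ = E₁ * ((χ 1 - 1) ^ 2 * κ) * E₂ by ring, ← hκeq]
  ring

end LocallyDependent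

end CompoundPoissonBound

/-! ### Hoeffding's covariance identity and quadrant dependence -/

section QuadrantDependence

open NormedSpace Finset

variable {𝔸 : Type*} [NormedCommRing 𝔸] [NormedAlgebra ℝ 𝔸] [CompleteSpace 𝔸] [NormOneClass 𝔸]
variable {Ω : Type*} [MeasurableSpace Ω] {μ : Measure Ω} [IsProbabilityMeasure μ]

/-- The expectation of a sum over a random finite set. -/
theorem hasSum_measureReal_smul {ι : Type*} [Countable ι] {F : Ω → Finset ι}
    (hF : ∀ i, MeasurableSet {ω | i ∈ F ω}) {W : Ω → ℝ} (hW : Integrable W μ)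
    (hFW : ∀ ω, ((F ω).card : ℝ) ≤ W ω) {c : ι → 𝔸} (hc : ∀ i, ‖c i‖ ≤ 1) :
    Summable (fun i => μ.real {ω | i ∈ F ω}) ∧
      HasSum (fun i => μ.real {ω | i ∈ F ω} • c i) (∫ ω, ∑ i ∈ F ω, c i ∂μ) := by
  classical
  have hone : ∀ i, Integrable ({ω | i ∈ F ω}.indicator (1 : Ω → ℝ)) μ := fun i =>
    (integrable_const (1 : ℝ)).indicator (hF i)
  have hsum : Summable (fun i => μ.real {ω | i ∈ F ω}) := by
    refine summable_of_sum_le (c := ∫ ω, W ω ∂μ) (fun _ => measureReal_nonneg) fun s => ?_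
    calc ∑ i ∈ s, μ.real {ω | i ∈ F ω}
        = ∫ ω, ∑ i ∈ s, {ω | i ∈ F ω}.indicator (1 : Ω → ℝ) ω ∂μ := by
          rw [integral_finsetSum _ fun i _ => hone i]
          exact sum_congr rfl fun i _ => (integral_indicator_one (hF i)).symm
      _ ≤ ∫ ω, W ω ∂μ := by
          refine integral_mono (integrable_finsetSum _ fun i _ => hone i) hW fun ω => ?_
          refine le_trans ?_ (hFW ω)
          simp only [Set.indicator_apply, Set.mem_ofPred_eq, Pi.one_apply, sum_boole]
          exact_mod_cast card_le_card fun x hx => (mem_filter.1 hx).2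
  refine ⟨hsum, ?_⟩
  have hint : ∀ i, Integrable ({ω | i ∈ F ω}.indicator fun _ => c i) μ := fun i =>
    (integrable_const (c i)).indicator (hF i)
  have hnorm : Summable fun i => ∫ ω, ‖{ω | i ∈ F ω}.indicator (fun _ => c i) ω‖ ∂μ := by
    refine hsum.of_nonneg_of_le (fun i => integral_nonneg fun _ => norm_nonneg _) fun i => ?_
    rw [← integral_indicator_one (hF i)]
    refine integral_mono (hint i).norm (hone i) fun ω => ?_
    by_cases h : i ∈ F ω <;> simp [h, hc i]
  have h := hasSum_integral_of_summable_integral_norm hint hnorm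
  convert! h using 1
  · ext i
    rw [integral_indicator_const _ (hF i)]
  · congr 1
    ext ω
    rw [tsum_eq_sum (s := F ω) fun i hi => by simp [hi]]
    exact sum_congr rfl fun i hi => by simp [hi]

/-- The trivial character with values in `ℝ`. -/
def trivialChar : BddChar ℝ := ⟨fun _ => 1, rfl, by simp, by simp⟩

/-- Under this character geometric sums become the variables themselves, so the transform identities
specialize to ordinary moments. -/
theorem trivialChar_geo {z : ℤ} (hz : 0 ≤ z) : trivialChar.geo z = z := by
  have : ((z.toNat : ℕ) : ℝ) = z := by exact_mod_cast Int.toNat_of_nonneg hz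
  simp [BddChar.geo, trivialChar, this]

/-- The joint upper tail `P(U > a, Y > b)` minus the product of the marginal ones. -/
def quadrantGap (μ : Measure Ω) (U Y : Ω → ℤ) (x : ℕ × ℕ) : ℝ :=
  μ.real {ω | (x.1 : ℤ) < U ω ∧ (x.2 : ℤ) < Y ω} -
    μ.real {ω | (x.1 : ℤ) < U ω} * μ.real {ω | (x.2 : ℤ) < Y ω}

section

variable {U Y : Ω → ℤ} (hU : Measurable U) (hY : Measurable Y) (hU0 : ∀ ω, 0 ≤ U ω)
  (hY0 : ∀ ω, 0 ≤ Y ω) (hU2 : MemLp (fun ω => (U ω : ℝ)) 2 μ)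
  (hY2 : MemLp (fun ω => (Y ω : ℝ)) 2 μ) (χ : BddChar 𝔸)
include hU hU0 hU2

/-- The tail formula for expectations, weighted by `χ`: `geo U` sums `χ a` over `0 ≤ a < U`. -/
theorem BddChar.hasSum_geo :
    Summable (fun a : ℕ => μ.real {ω | (a : ℤ) < U ω}) ∧
      HasSum (fun a : ℕ => μ.real {ω | (a : ℤ) < U ω} • χ a) (∫ ω, χ.geo (U ω) ∂μ) := by
  have e : ∀ (a : ℕ), {ω | (a : ℤ) < U ω} = {ω | a ∈ range (U ω).toNat} := fun a => by
    ext ω; simp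
  have h := hasSum_measureReal_smul (μ := μ) (F := fun ω => range (U ω).toNat)
    (fun a => by
      rw [← e]
      exact hU (MeasurableSet.of_discrete (s := {z : ℤ | (a : ℤ) < z})))
    (hU2.integrable one_le_two)
    (fun ω => by
      rw [card_range]
      exact_mod_cast (Int.toNat_of_nonneg (hU0 ω)).le)
    (c := fun a : ℕ => χ a) fun a => χ.norm_le _
  simp only [e]
  exact h

include hY hY0 hY2

theorem BddChar.hasSum_geo_mul_geo :
    Summable (fun x : ℕ × ℕ => μ.real {ω | (x.1 : ℤ) < U ω ∧ (x.2 : ℤ) < Y ω}) ∧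
      HasSum (fun x : ℕ × ℕ => μ.real {ω | (x.1 : ℤ) < U ω ∧ (x.2 : ℤ) < Y ω} •
        (χ x.1 * χ x.2)) (∫ ω, χ.geo (U ω) * χ.geo (Y ω) ∂μ) := by
  have e : ∀ (x : ℕ × ℕ), {ω | (x.1 : ℤ) < U ω ∧ (x.2 : ℤ) < Y ω} =
      {ω | x ∈ range (U ω).toNat ×ˢ range (Y ω).toNat} := fun a => by
    ext ω; simp
  have h := hasSum_measureReal_smul (μ := μ) (F := fun ω => range (U ω).toNat ×ˢ range (Y ω).toNat)
    (fun x => by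
      rw [← e]
      exact (hU (MeasurableSet.of_discrete (s := {z : ℤ | (x.1 : ℤ) < z}))).inter
        (hY (MeasurableSet.of_discrete (s := {z : ℤ | (x.2 : ℤ) < z}))))
    (hU2.integrable_mul hY2)
    (fun ω => by
      rw [card_product, card_range, card_range]
      have h1 : ((U ω).toNat : ℝ) = U ω := by exact_mod_cast Int.toNat_of_nonneg (hU0 ω)
      have h2 : ((Y ω).toNat : ℝ) = Y ω := by exact_mod_cast Int.toNat_of_nonneg (hY0 ω)
      rw [Nat.cast_mul, h1, h2]
      exact le_rfl)
    (c := fun x : ℕ × ℕ => χ x.1 * χ x.2) fun x => (norm_mul_le _ _).trans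
      (mul_le_one₀ (χ.norm_le _) (norm_nonneg _) (χ.norm_le _))
  simp only [e, BddChar.geo, sum_mul_sum, ← sum_product']
  exact h

/-- Hoeffding's identity with weights `χ a * χ b`. Square integrability makes both double series of
tails absolutely summable. -/
theorem BddChar.hasSum_quadrantGap :
    Summable (fun x => |quadrantGap μ U Y x|) ∧
      HasSum (fun x : ℕ × ℕ => quadrantGap μ U Y x • (χ x.1 * χ x.2))
        (∫ ω, χ.geo (U ω) * χ.geo (Y ω) ∂μ -
          (∫ ω, χ.geo (U ω) ∂μ) * ∫ ω, χ.geo (Y ω) ∂μ) := by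
  obtain ⟨s1, h1⟩ := χ.hasSum_geo hU hU0 hU2
  obtain ⟨s2, h2⟩ := χ.hasSum_geo hY hY0 hY2
  obtain ⟨s3, h3⟩ := χ.hasSum_geo_mul_geo hU hY hU0 hY0 hU2 hY2
  have s12 : Summable fun x : ℕ × ℕ =>
      μ.real {ω | (x.1 : ℤ) < U ω} * μ.real {ω | (x.2 : ℤ) < Y ω} :=
    s1.mul_of_nonneg s2 (fun _ => measureReal_nonneg) fun _ => measureReal_nonneg
  have key : ∀ (f g : ℕ → 𝔸) (x y : 𝔸), HasSum f x → HasSum g y →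
      Summable (fun z : ℕ × ℕ => f z.1 * g z.2) →
      HasSum (fun z : ℕ × ℕ => f z.1 * g z.2) (x * y) := fun _ _ _ _ h1 h2 h3 => h1.mul h2 h3
  have hprod : HasSum (fun x : ℕ × ℕ => (μ.real {ω | (x.1 : ℤ) < U ω} • χ x.1) *
      (μ.real {ω | (x.2 : ℤ) < Y ω} • χ x.2))
      ((∫ ω, χ.geo (U ω) ∂μ) * ∫ ω, χ.geo (Y ω) ∂μ) := by
    have hbd : ∀ (r : ℝ) (z : ℤ), 0 ≤ r → ‖r • χ z‖ ≤ r := fun r z hr => by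
      rw [norm_smul, Real.norm_of_nonneg hr]
      exact mul_le_of_le_one_right hr (χ.norm_le _)
    have hs : Summable fun x : ℕ × ℕ => (μ.real {ω | (x.1 : ℤ) < U ω} • χ x.1) *
        (μ.real {ω | (x.2 : ℤ) < Y ω} • χ x.2) :=
      Summable.of_norm_bounded s12 fun x => (norm_mul_le _ _).trans
        (mul_le_mul (hbd _ _ measureReal_nonneg) (hbd _ _ measureReal_nonneg) (norm_nonneg _)
          measureReal_nonneg)
    have hmul := key _ _ _ _ h1 h2
    exact hmul hs
  refine ⟨(s3.sub s12).abs, ?_⟩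
  convert! h3.sub hprod using 1
  ext x
  rw [quadrantGap, sub_smul, smul_mul_smul_comm]

/-- Quadrant dependence gives all gaps one sign, so the absolute value moves outside the sum, which
the trivial character identifies as the covariance. -/
theorem tsum_abs_quadrantGap
    (hQD : IsPQD μ (fun ω => (U ω : ℝ)) (fun ω => (Y ω : ℝ)) ∨
      IsNQD μ (fun ω => (U ω : ℝ)) (fun ω => (Y ω : ℝ))) :
    ∑' x, |quadrantGap μ U Y x| = |cov[fun ω => (U ω : ℝ), fun ω => (Y ω : ℝ); μ]| := by
  have hcov : ∑' x, quadrantGap μ U Y x = cov[fun ω => (U ω : ℝ), fun ω => (Y ω : ℝ); μ] := by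
    have h := (trivialChar.hasSum_quadrantGap hU hY hU0 hY0 hU2 hY2).2.tsum_eq
    simp only [trivialChar_geo (hU0 _), trivialChar_geo (hY0 _)] at h
    rw [covariance_eq_sub hU2 hY2]
    refine Eq.trans ?_ h
    simp [trivialChar]
  -- For integer values `a < V` means `a + 1 ≤ V`, the form of event used in the definition of
  -- quadrant dependence.
  have hset : ∀ (a : ℕ) (V : Ω → ℤ), {ω | (a : ℤ) < V ω} = {ω | ((a + 1 : ℕ) : ℝ) ≤ (V ω : ℝ)} :=
    fun a V => by
      ext ω
      have : ((a + 1 : ℕ) : ℝ) ≤ (V ω : ℝ) ↔ ((a + 1 : ℕ) : ℤ) ≤ V ω := by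
        rw [← Int.cast_natCast, Int.cast_le]
      simp only [Set.mem_ofPred_eq, this]
      push_cast
      exact Int.lt_iff_add_one_le
  have hgap : ∀ x : ℕ × ℕ, quadrantGap μ U Y x =
      μ.real {ω | ((x.1 + 1 : ℕ) : ℝ) ≤ (U ω : ℝ) ∧ ((x.2 + 1 : ℕ) : ℝ) ≤ (Y ω : ℝ)} -
      μ.real {ω | ((x.1 + 1 : ℕ) : ℝ) ≤ (U ω : ℝ)} *
        μ.real {ω | ((x.2 + 1 : ℕ) : ℝ) ≤ (Y ω : ℝ)} := fun x => by
    rw [quadrantGap, ← hset, ← hset, Set.ofPred_and, hset, hset, ← Set.ofPred_and]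
  rw [← hcov]
  rcases hQD with h | h
  · have hpos : ∀ x, 0 ≤ quadrantGap μ U Y x := fun x => by
      rw [hgap]; exact sub_nonneg.2 (h _ _)
    rw [abs_of_nonneg (tsum_nonneg hpos)]
    exact tsum_congr fun x => abs_of_nonneg (hpos x)
  · have hneg : ∀ x, quadrantGap μ U Y x ≤ 0 := fun x => by
      rw [hgap]; exact sub_nonpos.2 (h _ _)
    rw [abs_of_nonpos (tsum_nonpos hneg), ← tsum_neg]
    exact tsum_congr fun x => abs_of_nonpos (hneg x)

/-- Decoupling of quadrant dependent variables. -/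
theorem BddChar.exists_mean_sub_mean_mul_eq_of_quadrant
    (hQD : IsPQD μ (fun ω => (U ω : ℝ)) (fun ω => (Y ω : ℝ)) ∨
      IsNQD μ (fun ω => (U ω : ℝ)) (fun ω => (Y ω : ℝ))) :
    ∃ κ : 𝔸, ‖κ‖ ≤ |cov[fun ω => (U ω : ℝ), fun ω => (Y ω : ℝ); μ]| ∧
      χ.mean μ (fun ω => U ω + Y ω) - χ.mean μ U * χ.mean μ Y = (χ 1 - 1) ^ 2 * κ := by
  obtain ⟨s, h⟩ := χ.hasSum_quadrantGap hU hY hU0 hY0 hU2 hY2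
  have hUi := hU2.integrable one_le_two
  have hYi := hY2.integrable one_le_two
  refine ⟨∫ ω, χ.geo (U ω) * χ.geo (Y ω) ∂μ - (∫ ω, χ.geo (U ω) ∂μ) * ∫ ω, χ.geo (Y ω) ∂μ,
    ?_, ?_⟩
  · rw [← tsum_abs_quadrantGap hU hY hU0 hY0 hU2 hY2 hQD]
    refine h.norm_le_of_bounded s.hasSum fun x => ?_
    rw [norm_smul, Real.norm_eq_abs]
    exact mul_le_of_le_one_right (abs_nonneg _) ((norm_mul_le _ _).trans
      (mul_le_one₀ (χ.norm_le _) (norm_nonneg _) (χ.norm_le _)))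
  · have hgg : Integrable (fun ω => χ.geo (U ω) * χ.geo (Y ω)) μ := by
      refine (hU2.integrable_mul hY2).mono' ((stronglyMeasurable_comp_discrete hU _).mul
        (stronglyMeasurable_comp_discrete hY _)).aestronglyMeasurable
        (Filter.Eventually.of_forall fun ω => (norm_mul_le _ _).trans ?_)
      exact mul_le_mul (χ.norm_geo_le (hU0 ω)) (χ.norm_geo_le (hY0 ω)) (norm_nonneg _)
        (Int.cast_nonneg (hU0 ω))
    have e1 := χ.mean_sub_one_eq_mul_geo hU hU0 hUi
    have e2 := χ.mean_sub_one_eq_mul_geo hY hY0 hYi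
    -- Pointwise the left side is `(χ(U) - 1)(χ(Y) - 1)`, and each factor yields a `χ 1 - 1`.
    have e3 : χ.mean μ (fun ω => U ω + Y ω) - χ.mean μ U - χ.mean μ Y + 1 =
        (χ 1 - 1) ^ 2 * ∫ ω, χ.geo (U ω) * χ.geo (Y ω) ∂μ := by
      have i1 := χ.integrable_comp (μ := μ) hU
      have i2 := χ.integrable_comp (μ := μ) hY
      have i3 := χ.integrable_comp (μ := μ) (hU.add hY)
      rw [← integral_const_mul_of_integrable hgg, BddChar.mean, BddChar.mean, BddChar.mean,
        ← integral_sub (f := fun ω => χ (U ω + Y ω)) i3 i1,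
        ← integral_sub (f := fun ω => χ (U ω + Y ω) - χ (U ω)) (i3.sub i1) i2]
      rw [show ∀ z : 𝔸, z + 1 = z + ∫ _, (1 : 𝔸) ∂μ from fun z => by simp,
        ← integral_add (f := fun ω => χ (U ω + Y ω) - χ (U ω) - χ (Y ω))
          ((i3.sub i1).sub i2) (integrable_const _)]
      congr 1
      ext ω
      rw [χ.map_add, show (χ 1 - 1) ^ 2 * (χ.geo (U ω) * χ.geo (Y ω)) =
        ((χ 1 - 1) * χ.geo (U ω)) * ((χ 1 - 1) * χ.geo (Y ω)) by ring,
        ← χ.sub_one_eq (hU0 ω), ← χ.sub_one_eq (hY0 ω)]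
      ring
    rw [mul_sub, ← e3, show ∀ x y : 𝔸, (χ 1 - 1) ^ 2 * (x * y) =
      ((χ 1 - 1) * x) * ((χ 1 - 1) * y) from fun x y => by ring, ← e1, ← e2]
    ring

end

end QuadrantDependence

/-! ### Crude and smooth estimates of the replacement errors -/

section ReplacementBounds

open NormedSpace Finset

variable {𝔸 : Type*} [NormedCommRing 𝔸] [NormedAlgebra ℝ 𝔸] [CompleteSpace 𝔸] [NormOneClass 𝔸]
variable {Ω : Type*} [MeasurableSpace Ω] {μ : Measure Ω} [IsProbabilityMeasure μ]

namespace LocallyDependent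

variable {X : ℤ → Ω → ℤ} {k n : ℕ} (hX : LocallyDependent μ X k n) (χ : BddChar 𝔸)
include hX

theorem norm_replacement_one_le {i : ℤ} (hk : 1 ≤ k) (hi : i ≤ n) :
    ‖χ.replacement μ X 1 i‖ ≤ 4 * (localWeight μ X k i + 1 / 2 * probNonzero μ (X i) ^ 2) := by
  rw [← hX.replacement_one_eq χ (min_le_left 1 (i - k + 1))]
  exact (hX.norm_replacement_le χ (min_le_right _ _) hk hi).trans (le_of_eq (by ring))

theorem integral_blockSum_mul {a b i : ℤ} (hb : b ≤ n) (hi : i ≤ n) :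
    ∫ ω, (blockSum X a b ω : ℝ) * X i ω ∂μ = ∑ j ∈ Icc a b, ∫ ω, (X i ω : ℝ) * X j ω ∂μ := by
  rw [← integral_finsetSum _ fun j hj => hX.integrable_mul hi ((mem_Icc.1 hj).2.trans hb)]
  congr 1
  ext ω
  rw [← mul_sum, mul_comm, blockSum]
  push_cast
  rfl

theorem integral_blockSum {a b : ℤ} (hb : b ≤ n) :
    ∫ ω, (blockSum X a b ω : ℝ) ∂μ = ∑ j ∈ Icc a b, ∫ ω, (X j ω : ℝ) ∂μ := by
  rw [← integral_finsetSum _ fun j hj => hX.integrable ((mem_Icc.1 hj).2.trans hb)]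
  congr 1
  ext ω
  rw [blockSum]
  push_cast
  rfl

/-- Both factors of the interaction are differences, so each yields a `χ 1 - 1`. What remains is
dominated by `B (X_i + E X_i)`, whose expectation gives the mixed moments. -/
theorem exists_replacement_eq {a i : ℤ} (ha : a ≤ i - k + 1) (hk : 1 ≤ k) (hi : i ≤ n) :
    ∃ κ : 𝔸, ‖κ‖ ≤ ∑ j ∈ Icc (i - k + 1) (i - 1),
        ((∫ ω, (X i ω : ℝ) * (X j ω : ℝ) ∂μ)
          + (∫ ω, (X i ω : ℝ) ∂μ) * (∫ ω, (X j ω : ℝ) ∂μ))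
        + 1 / 2 * (∫ ω, (X i ω : ℝ) ∂μ) ^ 2 ∧
      χ.replacement μ X a i = (χ 1 - 1) ^ 2 * κ := by
  obtain ⟨κ₂, h2, e2⟩ := χ.exists_mean_sub_exp_eq (hX.meas i hi) (hX.nonneg i hi)
    (hX.integrable hi)
  set B := blockSum X (i - k + 1) (i - 1) with hB
  set g := ∫ ω, χ.geo (X i ω) ∂μ with hg
  have hBn : i - 1 ≤ n := by omega
  have hBm : Measurable B := hX.measurable_blockSum _ hBn
  have hQm := hX.measurable_blockSum a (b := i - k) (by omega)
  have hB0 : ∀ ω, 0 ≤ B ω := hX.blockSum_nonneg _ hBn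
  have hgle : ‖g‖ ≤ ∫ ω, (X i ω : ℝ) ∂μ :=
    χ.norm_integral_geo_le (hX.nonneg i hi) (hX.integrable hi)
  set K : Ω → 𝔸 := fun ω => χ (blockSum X a (i - k) ω) * (χ.geo (B ω) * (χ.geo (X i ω) - g))
    with hK
  have hKbd : ∀ ω, ‖K ω‖ ≤ (B ω : ℝ) * X i ω + (∫ ω, (X i ω : ℝ) ∂μ) * B ω := fun ω => by
    have h1 : ‖χ.geo (X i ω) - g‖ ≤ X i ω + ∫ ω, (X i ω : ℝ) ∂μ :=
      (norm_sub_le _ _).trans (add_le_add (χ.norm_geo_le (hX.nonneg i hi ω)) hgle)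
    have h3 : (0 : ℝ) ≤ B ω := Int.cast_nonneg (hB0 ω)
    calc ‖K ω‖ ≤ ‖χ.geo (B ω) * (χ.geo (X i ω) - g)‖ :=
          (norm_mul_le _ _).trans (mul_le_of_le_one_left (norm_nonneg _) (χ.norm_le _))
      _ ≤ B ω * (X i ω + ∫ ω, (X i ω : ℝ) ∂μ) :=
          (norm_mul_le _ _).trans (mul_le_mul (χ.norm_geo_le (hB0 ω)) h1 (norm_nonneg _) h3)
      _ = _ := by ring
  have hBi : Integrable (fun ω => (B ω : ℝ)) μ :=
    (hX.memLp_blockSum _ hBn).integrable one_le_two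
  have hBX : Integrable (fun ω => (B ω : ℝ) * X i ω) μ :=
    (hX.memLp_blockSum _ hBn).integrable_mul (hX.memLp i hi)
  have hint : Integrable (fun ω => (B ω : ℝ) * X i ω + (∫ ω, (X i ω : ℝ) ∂μ) * B ω) μ :=
    hBX.add (hBi.const_mul _)
  have hKint : Integrable K μ := hint.mono' ((stronglyMeasurable_comp_discrete hQm _).mul
    ((stronglyMeasurable_comp_discrete hBm _).mul
      ((stronglyMeasurable_comp_discrete (hX.meas i hi) _).sub
        stronglyMeasurable_const))).aestronglyMeasurable (Filter.Eventually.of_forall hKbd)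
  refine ⟨∫ ω, K ω ∂μ + χ.mean μ (blockSum X a (i - 1)) * κ₂, ?_, ?_⟩
  · refine (norm_add_le _ _).trans (add_le_add ?_ ((norm_mul_le _ _).trans
      ((mul_le_of_le_one_left (norm_nonneg _) (χ.norm_mean_le _)).trans h2)))
    refine (norm_integral_le_of_norm_le hint (Filter.Eventually.of_forall hKbd)).trans
      (le_of_eq ?_)
    rw [integral_add hBX (hBi.const_mul _), integral_const_mul, sum_add_distrib, ← mul_sum]
    exact congrArg₂ (· + ·) (hX.integral_blockSum_mul hBn hi)
      (congrArg _ (hX.integral_blockSum hBn))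
  · rw [hX.replacement_eq χ ha hk hi, e2, mul_add, ← integral_const_mul_of_integrable hKint]
    congr 1
    · congr 1
      ext ω
      have e3 : χ (X i ω) - χ.mean μ (X i) = (χ 1 - 1) * (χ.geo (X i ω) - g) := by
        rw [mul_sub, ← χ.sub_one_eq (hX.nonneg i hi ω), hg,
          ← χ.mean_sub_one_eq_mul_geo (hX.meas i hi) (hX.nonneg i hi) (hX.integrable hi)]
        ring
      rw [BddChar.interaction, e3, ← hB, χ.sub_one_eq (hB0 ω), hK]
      ring
    · ring

/-- Variables at distance at least `k` from `X_i` are independent of it, so only its left neighbours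
contribute covariance. -/
theorem covariance_blockSum_le {a i : ℤ} (ha : a ≤ i - k + 1) (hi : i ≤ n) :
    |cov[fun ω => (blockSum X a (i - 1) ω : ℝ), fun ω => (X i ω : ℝ); μ]| ≤
      ∑ j ∈ Icc (i - k + 1) (i - 1), |cov[fun ω => (X i ω : ℝ), fun ω => (X j ω : ℝ); μ]| := by
  have hsum : cov[fun ω => (blockSum X a (i - 1) ω : ℝ), fun ω => (X i ω : ℝ); μ] =
      ∑ j ∈ Icc a (i - 1), cov[fun ω => (X j ω : ℝ), fun ω => (X i ω : ℝ); μ] := by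
    rw [← covariance_fun_sum_left' (fun j hj => hX.memLp j (by
      rw [mem_Icc] at hj; omega)) (hX.memLp i hi)]
    simp only [blockSum]
    push_cast
    rfl
  have hzero : ∀ j ∈ Icc a (i - 1), j ∉ Icc (i - (k : ℤ) + 1) (i - 1) →
      cov[fun ω => (X j ω : ℝ), fun ω => (X i ω : ℝ); μ] = 0 := by
    intro j hj hj'
    simp only [mem_Icc] at hj hj'
    have hind := hX.indepFun_blockSum (c := i - k) (a := j) (b := j) (a' := i) (b' := i)
      (a'' := i) (b'' := i) (i := i) (by omega) (by omega) (by omega) hi (by omega) hi (by omega) hi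
    have h2 : IndepFun (fun ω => (X j ω : ℝ)) (fun ω => (X i ω : ℝ)) μ := by
      have := hind.comp (φ := fun z : ℤ => (z : ℝ)) (ψ := fun z : ℤ × ℤ × ℤ => (z.2.2 : ℝ))
        .of_discrete .of_discrete
      simpa [Function.comp_def, blockSum] using this
    exact h2.covariance_eq_zero (hX.memLp j (by omega)) (hX.memLp i hi)
  rw [hsum, ← sum_subset (Icc_subset_Icc_left ha) hzero]
  refine (abs_sum_le_sum_abs _ _).trans (sum_le_sum fun j _ => ?_)
  rw [covariance_comm]

theorem quadrant_blockSum {a i : ℤ} (hi : i ≤ n)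
    (hQD : ∀ i j : ℤ, 1 ≤ j → j < i → i ≤ n →
      IsPQD μ (fun ω => ∑ t ∈ Icc j (i - 1), (X t ω : ℝ)) (fun ω => (X i ω : ℝ)) ∨
      IsNQD μ (fun ω => ∑ t ∈ Icc j (i - 1), (X t ω : ℝ)) (fun ω => (X i ω : ℝ))) :
    IsPQD μ (fun ω => (blockSum X a (i - 1) ω : ℝ)) (fun ω => (X i ω : ℝ)) ∨
      IsNQD μ (fun ω => (blockSum X a (i - 1) ω : ℝ)) (fun ω => (X i ω : ℝ)) := by
  have hmax : ∀ ω, blockSum X a (i - 1) ω = blockSum X (max 1 a) (i - 1) ω := fun ω => by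
    rcases le_total a 1 with h | h
    · rw [max_eq_left h, hX.blockSum_eq_of_le_one h]
    · rw [max_eq_right h]
  rcases lt_or_ge (max 1 a) i with h | h
  · have := hQD i (max 1 a) (le_max_left _ _) h hi
    rw [funext hmax]
    simpa only [blockSum, Int.cast_sum] using this
  -- No index from `1` on is left in the block; the constant `0` is quadrant dependent with any
  -- variable.
  · have h0 : ∀ ω, blockSum X a (i - 1) ω = 0 := fun ω => by
      rw [hmax, blockSum, Icc_eq_empty (by omega), sum_empty]
    left
    intro x₁ x₂
    simp only [h0, Int.cast_zero]
    by_cases hx : x₁ ≤ 0 <;> simp [hx]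

/-- The hypothesis concerns the whole block preceding `X_i`, so the two are decoupled directly,
without passing through the interaction. -/
theorem exists_replacement_eq_of_quadrant {a i : ℤ} (ha : a ≤ i - k + 1) (hk : 1 ≤ k) (hi : i ≤ n)
    (hQD : ∀ i j : ℤ, 1 ≤ j → j < i → i ≤ n →
      IsPQD μ (fun ω => ∑ t ∈ Icc j (i - 1), (X t ω : ℝ)) (fun ω => (X i ω : ℝ)) ∨
      IsNQD μ (fun ω => ∑ t ∈ Icc j (i - 1), (X t ω : ℝ)) (fun ω => (X i ω : ℝ))) :
    ∃ κ : 𝔸, ‖κ‖ ≤ ∑ j ∈ Icc (i - k + 1) (i - 1),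
        |cov[fun ω => (X i ω : ℝ), fun ω => (X j ω : ℝ); μ]|
        + 1 / 2 * (∫ ω, (X i ω : ℝ) ∂μ) ^ 2 ∧
      χ.replacement μ X a i = (χ 1 - 1) ^ 2 * κ := by
  obtain ⟨κ₂, h2, e2⟩ := χ.exists_mean_sub_exp_eq (hX.meas i hi) (hX.nonneg i hi)
    (hX.integrable hi)
  have hn : i - 1 ≤ n := by omega
  obtain ⟨κ₁, h1, e1⟩ := χ.exists_mean_sub_mean_mul_eq_of_quadrant
    (hX.measurable_blockSum a hn) (hX.meas i hi) (hX.blockSum_nonneg a hn) (hX.nonneg i hi)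
    (hX.memLp_blockSum a hn) (hX.memLp i hi) (hX.quadrant_blockSum hi hQD)
  refine ⟨κ₁ + χ.mean μ (blockSum X a (i - 1)) * κ₂, ?_, ?_⟩
  · refine (norm_add_le _ _).trans (add_le_add (h1.trans (hX.covariance_blockSum_le ha hi)) ?_)
    exact (norm_mul_le _ _).trans
      ((mul_le_of_le_one_left (norm_nonneg _) (χ.norm_mean_le _)).trans h2)
  · have e3 : (fun ω => blockSum X a (i - 1) ω + X i ω) = blockSum X a i :=
      funext fun ω => (blockSum_succ X (by omega) ω).symm
    rw [e3] at e1
    rw [mul_add, ← e1, mul_left_comm, ← e2, BddChar.replacement]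
    ring

/-- The smooth representation also serves as the crude one, since `‖(χ 1 - 1)^2‖ ≤ 4`. -/
theorem norm_replacement_one_le_of_quadrant {i : ℤ} (hk : 1 ≤ k) (hi : i ≤ n)
    (hQD : ∀ i j : ℤ, 1 ≤ j → j < i → i ≤ n →
      IsPQD μ (fun ω => ∑ t ∈ Icc j (i - 1), (X t ω : ℝ)) (fun ω => (X i ω : ℝ)) ∨
      IsNQD μ (fun ω => ∑ t ∈ Icc j (i - 1), (X t ω : ℝ)) (fun ω => (X i ω : ℝ))) :
    ‖χ.replacement μ X 1 i‖ ≤ 4 * (∑ j ∈ Icc (i - k + 1) (i - 1),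
        |cov[fun ω => (X i ω : ℝ), fun ω => (X j ω : ℝ); μ]|
        + 1 / 2 * (∫ ω, (X i ω : ℝ) ∂μ) ^ 2) := by
  obtain ⟨κ, hκ, e⟩ := hX.exists_replacement_eq_of_quadrant χ (min_le_right 1 (i - k + 1)) hk hi hQD
  rw [← hX.replacement_one_eq χ (min_le_left 1 (i - k + 1)), e]
  have h4 : ‖(χ 1 - 1) ^ 2‖ ≤ 4 := (norm_pow_le _ _).trans
    (by nlinarith [χ.norm_sub_one_le_two 1, norm_nonneg (χ 1 - 1)])
  exact (norm_mul_le _ _).trans (mul_le_mul h4 hκ (norm_nonneg _) (by norm_num))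

end LocallyDependent

end ReplacementBounds

/-! ### The Banach algebra of translations and total variation -/

section ShiftAlgebra

open scoped BoundedContinuousFunction

/-- Bounded real functions on `ℤ`. -/
def BddFun : Type := ℤ →ᵇ ℝ

instance : NormedAddCommGroup BddFun := inferInstanceAs (NormedAddCommGroup (ℤ →ᵇ ℝ))

instance : NormedSpace ℝ BddFun := inferInstanceAs (NormedSpace ℝ (ℤ →ᵇ ℝ))

instance : CompleteSpace BddFun := inferInstanceAs (CompleteSpace (ℤ →ᵇ ℝ))

/-- The bounded function with values `f`. -/
def BddFun.mk (f : ℤ → ℝ) {C : ℝ} (hf : ∀ x, |f x| ≤ C) : BddFun :=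
  BoundedContinuousFunction.ofNormedAddCommGroupDiscrete f C hf

/-- The value of a bounded function. -/
def BddFun.eval (f : BddFun) (x : ℤ) : ℝ := BoundedContinuousFunction.instFunLike.coe f x

theorem BddFun.ext {f g : BddFun} (h : ∀ x, f.eval x = g.eval x) : f = g :=
  BoundedContinuousFunction.ext h

theorem BddFun.abs_eval_le (f : BddFun) (x : ℤ) : |f.eval x| ≤ ‖f‖ :=
  BoundedContinuousFunction.norm_coe_le_norm (α := ℤ) (β := ℝ) f x

theorem BddFun.norm_mk_le {f : ℤ → ℝ} {C : ℝ} (hC : 0 ≤ C) (hf : ∀ x, |f x| ≤ C) :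
    ‖BddFun.mk f hf‖ ≤ C :=
  BoundedContinuousFunction.norm_ofNormedAddCommGroup_le (f := f) _ hC hf

instance : Nontrivial BddFun :=
  ⟨BddFun.mk (fun _ => 0) (C := 0) (by simp), BddFun.mk (fun _ => 1) (C := 1) (by simp), fun h =>
    zero_ne_one (congrArg (fun f : BddFun => f.eval 0) h)⟩

/-- Translation by `z` on bounded functions on `ℤ`. -/
def shiftOp (z : ℤ) : BddFun →L[ℝ] BddFun :=
  LinearMap.mkContinuous
    { toFun := fun f => BddFun.mk (fun x => f.eval (x + z)) fun x => f.abs_eval_le (x + z)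
      map_add' := fun f g => BddFun.ext fun x => rfl
      map_smul' := fun c f => BddFun.ext fun x => rfl } 1 fun f => by
    rw [one_mul]
    exact BddFun.norm_mk_le (norm_nonneg f) fun x => f.abs_eval_le (x + z)

theorem norm_shiftOp_le (z : ℤ) : ‖shiftOp z‖ ≤ 1 :=
  LinearMap.mkContinuous_norm_le _ zero_le_one _

theorem shiftOp_add (a b : ℤ) : shiftOp (a + b) = shiftOp a * shiftOp b := by
  refine ContinuousLinearMap.ext fun f => BddFun.ext fun x => ?_
  change f.eval (x + (a + b)) = f.eval (x + a + b)
  rw [add_assoc]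

theorem shiftOp_zero : shiftOp 0 = 1 := by
  refine ContinuousLinearMap.ext fun f => BddFun.ext fun x => ?_
  change f.eval (x + 0) = f.eval x
  rw [add_zero]

/-- The closed algebra of operators generated by the translations. -/
def shiftSubalgebra : Subalgebra ℝ (BddFun →L[ℝ] BddFun) :=
  (Algebra.adjoin ℝ (Set.range shiftOp)).topologicalClosure

/-- Translations commute, hence so does the closed algebra they generate, unlike the algebra of all
bounded operators. -/
theorem shiftSubalgebra_mul_comm (S T : shiftSubalgebra) : S * T = T * S :=
  (Subalgebra.commRingTopologicalClosure (Algebra.adjoin ℝ (Set.range shiftOp))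
    (Algebra.isMulCommutative_adjoin ℝ (by
      rintro _ ⟨a, rfl⟩ _ ⟨b, rfl⟩
      rw [← shiftOp_add, ← shiftOp_add, add_comm])).is_comm.comm).mul_comm S T

/-- The Banach algebra `shiftSubalgebra` as a type. -/
def ShiftAlgebra : Type := shiftSubalgebra

instance : NormedRing ShiftAlgebra := inferInstanceAs (NormedRing shiftSubalgebra)

instance : NormedCommRing ShiftAlgebra :=
  { (inferInstance : NormedRing ShiftAlgebra) with mul_comm := shiftSubalgebra_mul_comm }

instance : NormedAlgebra ℝ ShiftAlgebra := inferInstanceAs (NormedAlgebra ℝ shiftSubalgebra)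

instance : CompleteSpace ShiftAlgebra :=
  (Subalgebra.isClosed_topologicalClosure
    (Algebra.adjoin ℝ (Set.range shiftOp))).completeSpace_coe

instance : NormOneClass ShiftAlgebra := ⟨norm_one (α := BddFun →L[ℝ] BddFun)⟩

/-- The operator underlying an element of `ShiftAlgebra`. -/
def ShiftAlgebra.op (T : ShiftAlgebra) : BddFun →L[ℝ] BddFun := Subtype.val T

/-- The translations, as a bounded character with values in the algebra they generate. -/
def shiftChar : BddChar ShiftAlgebra where
  toFun z := ⟨shiftOp z, Subalgebra.le_topologicalClosure _ (Algebra.subset_adjoin ⟨z, rfl⟩)⟩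
  map_zero := Subtype.ext shiftOp_zero
  map_add a b := Subtype.ext (shiftOp_add a b)
  norm_le z := norm_shiftOp_le z

/-- Evaluation of an operator at a bounded function and the origin. -/
def shiftEval (f : BddFun) : ShiftAlgebra →L[ℝ] ℝ :=
  LinearMap.mkContinuous
    { toFun := fun T => (T.op f).eval 0
      map_add' := fun _ _ => rfl
      map_smul' := fun _ _ => rfl } ‖f‖ fun T => by
    refine (BddFun.abs_eval_le _ _).trans ?_
    rw [mul_comm]
    exact T.op.le_opNorm f

theorem shiftEval_shiftChar (f : BddFun) (z : ℤ) : shiftEval f (shiftChar z) = f.eval z := by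
  change f.eval (0 + z) = f.eval z
  rw [zero_add]

theorem norm_shiftEval_le (f : BddFun) : ‖shiftEval f‖ ≤ ‖f‖ :=
  LinearMap.mkContinuous_norm_le _ (norm_nonneg _) _

/-- The total variation distance is bounded by the operator norm. -/
theorem dTV_le_norm_sub (P Q : Measure ℤ) [IsProbabilityMeasure P] [IsProbabilityMeasure Q] :
    dTV P Q ≤ 1 / 2 * ‖shiftChar.mean P id - shiftChar.mean Q id‖ := by
  classical
  refine Real.iSup_le (fun A => ?_) (by positivity)
  -- Testing with `2 · 1_A - 1`, of sup norm at most `1`, instead of `1_A` gains the factor `1/2`.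
  have hf : ∀ x : ℤ, |2 * A.indicator (fun _ => (1 : ℝ)) x - 1| ≤ 1 := fun x => by
    by_cases h : x ∈ A <;> simp [h]; norm_num
  have key : ∀ (ν : Measure ℤ) [IsProbabilityMeasure ν],
      shiftEval (BddFun.mk _ hf) (shiftChar.mean ν id) = 2 * ν.real A - 1 := fun ν _ => by
    rw [BddChar.mean, ← ContinuousLinearMap.integral_comp_comm _
      (shiftChar.integrable_comp measurable_id)]
    simp only [shiftEval_shiftChar, id]
    change ∫ z, (2 * A.indicator (fun _ => (1 : ℝ)) z - 1) ∂ν = _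
    rw [integral_sub (((integrable_const _).indicator (MeasurableSet.of_discrete)).const_mul _)
      (integrable_const _), integral_const_mul, integral_indicator_const _ MeasurableSet.of_discrete]
    simp
  have h := (shiftEval (BddFun.mk _ hf)).le_opNorm (shiftChar.mean P id - shiftChar.mean Q id)
  rw [map_sub, key P, key Q, Real.norm_eq_abs,
    show 2 * P.real A - 1 - (2 * Q.real A - 1) = 2 * (P.real A - Q.real A) by ring, abs_mul,
    abs_two] at h
  have h2 := (norm_shiftEval_le (BddFun.mk _ hf)).trans (BddFun.norm_mk_le zero_le_one hf)
  nlinarith [norm_nonneg (shiftChar.mean P id - shiftChar.mean Q id)]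

end ShiftAlgebra

/-! ### The transform of a compound Poisson law and the smoothness factor -/

section CompoundPoissonTransform

open NormedSpace

variable {𝔸 : Type*} [NormedCommRing 𝔸] [NormedAlgebra ℝ 𝔸] [CompleteSpace 𝔸] [NormOneClass 𝔸]
variable (χ : BddChar 𝔸)

theorem summable_abs_backDiff {f : ℤ → ℝ} (hf : Summable fun z => |f z|) :
    Summable fun z => |backDiff f z| := by
  have h : Summable fun z : ℤ => |f (z - 1)| :=
    (Equiv.subRight (1 : ℤ)).summable_iff (f := fun z => |f z|) |>.2 hf
  exact (hf.add h).of_nonneg_of_le (fun _ => abs_nonneg _) fun z => abs_sub _ _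

theorem BddChar.summable_smul {f : ℤ → ℝ} (hf : Summable fun z => |f z|) :
    Summable fun z => f z • χ z :=
  Summable.of_norm_bounded hf fun z => by
    rw [norm_smul, Real.norm_eq_abs]
    exact mul_le_of_le_one_right (abs_nonneg _) (χ.norm_le z)

/-- Multiplication by `χ 1` shifts the coefficients by one place, so `χ 1 - 1` acts on them as minus
the backward difference. -/
theorem BddChar.sub_one_mul_tsum {f : ℤ → ℝ} (hf : Summable fun z => |f z|) :
    (χ 1 - 1) * ∑' z, f z • χ z = -∑' z, backDiff f z • χ z := by
  have h1 := χ.summable_smul hf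
  have h2 : χ 1 * ∑' z, f z • χ z = ∑' z, f (z - 1) • χ z := by
    rw [← h1.tsum_mul_left, ← (Equiv.subRight (1 : ℤ)).tsum_eq]
    refine tsum_congr fun z => ?_
    rw [Equiv.subRight_apply, mul_smul_comm, ← χ.map_add]
    congr 2
    ring
  have h3 : Summable fun z : ℤ => f (z - 1) • χ z := by
    have := (χ.summable_smul hf).mul_left (χ 1)
    rw [← (Equiv.subRight (1 : ℤ)).summable_iff] at this
    refine this.congr fun z => ?_
    simp only [Function.comp_apply, Equiv.subRight_apply]
    rw [mul_smul_comm, ← χ.map_add]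
    congr 2
    ring
  rw [sub_mul, one_mul, h2, ← h3.tsum_sub h1, ← tsum_neg]
  refine tsum_congr fun z => ?_
  rw [backDiff, ← sub_smul, ← neg_smul, neg_sub]

theorem BddChar.norm_sq_mul_mean_le (P : Measure ℤ) [IsProbabilityMeasure P] :
    ‖(χ 1 - 1) ^ 2 * χ.mean P id‖ ≤ smoothnessFactor P := by
  have hf : Summable fun z => |probFun P z| := by
    refine (summable_of_sum_le (c := 1) (fun z => abs_nonneg _) fun s => ?_)
    simp only [probFun, abs_of_nonneg measureReal_nonneg]
    rw [sum_measureReal_singleton]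
    exact measureReal_le_one
  have hmean : χ.mean P id = ∑' z, probFun P z • χ z :=
    integral_countable (χ.integrable_comp measurable_id)
  have h1 := summable_abs_backDiff hf
  have h2 := summable_abs_backDiff h1
  rw [hmean, pow_two, mul_assoc, χ.sub_one_mul_tsum hf, mul_neg, χ.sub_one_mul_tsum h1, neg_neg]
  refine (χ.summable_smul h2).hasSum.norm_le_of_bounded h2.hasSum fun z => ?_
  rw [norm_smul, Real.norm_eq_abs]
  exact mul_le_of_le_one_right (abs_nonneg _) (χ.norm_le z)

theorem measurable_iidSum (r : ℕ) : Measurable fun y : Fin r → ℤ => ∑ s, y s := by fun_prop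

theorem BddChar.mean_iidSumLaw (F : Measure ℤ) [IsProbabilityMeasure F] (r : ℕ) :
    χ.mean (iidSumLaw F r) id = χ.mean F id ^ r := by
  have hind : iIndepFun (fun (i : Fin r) (y : Fin r → ℤ) => y i) (Measure.pi fun _ : Fin r => F) :=
    iIndepFun_pi (X := fun _ => id) fun _ => aemeasurable_id
  have hone : ∀ i : Fin r, ∫ y : Fin r → ℤ, χ (y i) ∂(Measure.pi fun _ : Fin r => F) =
      χ.mean F id := fun i => by
    have h := (measurePreserving_eval (fun _ : Fin r => F) i).map_eq
    conv_rhs => rw [BddChar.mean, ← h]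
    rw [integral_map (measurable_pi_apply i).aemeasurable
      StronglyMeasurable.of_discrete.aestronglyMeasurable]
    rfl
  have hs : ∀ s : Finset (Fin r),
      ∫ y : Fin r → ℤ, χ (∑ i ∈ s, y i) ∂(Measure.pi fun _ : Fin r => F) =
        χ.mean F id ^ s.card := by
    intro s
    induction s using Finset.induction_on with
    | empty => simp [χ.map_zero]
    | insert a s ha ih =>
      have h1 : IndepFun (fun y : Fin r → ℤ => ∑ i ∈ s, y i) (fun y => y a)
          (Measure.pi fun _ : Fin r => F) := by
        have := hind.indepFun_finsetSum_of_notMem (fun i => measurable_pi_apply i) ha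
        convert! this using 1
        ext y
        simp
      rw [Finset.card_insert_of_notMem ha, pow_succ, ← ih, ← hone a,
        ← integral_mul_comp_of_indepFun (a := χ.toFun) (b := χ.toFun) h1 (by fun_prop)
          (measurable_pi_apply a) χ.norm_le χ.norm_le]
      congr 1
      ext y
      rw [Finset.sum_insert ha, add_comm, χ.map_add]
  rw [BddChar.mean, iidSumLaw, integral_map (measurable_iidSum r).aemeasurable
    StronglyMeasurable.of_discrete.aestronglyMeasurable]
  simpa using hs Finset.univ

theorem compoundPoisson_eq_sum (a : ℝ) (F : Measure ℤ) :
    compoundPoisson a F = Measure.sum fun r : ℕ =>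
      ENNReal.ofReal (Real.exp (-a.toNNReal) * a.toNNReal ^ r / r.factorial) • iidSumLaw F r := by
  refine Measure.ext fun s hs => ?_
  rw [compoundPoisson, Measure.bind_apply hs Measurable.of_discrete.aemeasurable, poissonMeasure,
    lintegral_sum_measure, Measure.sum_apply _ hs]
  refine tsum_congr fun r => ?_
  rw [lintegral_smul_measure, lintegral_dirac, Measure.smul_apply]

theorem isProbabilityMeasure_iidSumLaw (F : Measure ℤ) [IsProbabilityMeasure F] (r : ℕ) :
    IsProbabilityMeasure (iidSumLaw F r) :=
  Measure.isProbabilityMeasure_map (measurable_iidSum r).aemeasurable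

/-- The empty sum has a law whatever `F` is; this covers rate `0`, where `F_n` is the zero measure.
-/
theorem isProbabilityMeasure_iidSumLaw_zero (F : Measure ℤ) :
    IsProbabilityMeasure (iidSumLaw F 0) := by
  have : (Measure.pi fun _ : Fin 0 => F) = Measure.dirac (fun i => i.elim0) :=
    Measure.pi_of_empty _ _
  have : IsProbabilityMeasure (Measure.pi fun _ : Fin 0 => F) := by rw [this]; infer_instance
  exact Measure.isProbabilityMeasure_map (measurable_iidSum 0).aemeasurable

theorem isProbabilityMeasure_compoundPoisson {a : ℝ} {F : Measure ℤ}
    (hF : a ≤ 0 ∨ IsProbabilityMeasure F) : IsProbabilityMeasure (compoundPoisson a F) := by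
  constructor
  rw [compoundPoisson, Measure.bind_apply MeasurableSet.univ Measurable.of_discrete.aemeasurable]
  rcases hF with ha | hF
  · have := isProbabilityMeasure_iidSumLaw_zero F
    rw [Real.toNNReal_of_nonpos ha, poissonMeasure, lintegral_sum_measure, tsum_eq_single 0]
    · simp
    · intro r hr
      simp [hr]
  · have := fun r => isProbabilityMeasure_iidSumLaw F r
    simp

/-- The transform of an `r`-fold sum is an `r`-th power, so the Poisson weights produce the
exponential series. -/
theorem BddChar.mean_compoundPoisson {a : ℝ} (ha : 0 ≤ a) {F : Measure ℤ}
    (hF : a ≤ 0 ∨ IsProbabilityMeasure F) :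
    χ.mean (compoundPoisson a F) id = exp (a • (χ.mean F id - 1)) := by
  have hP := isProbabilityMeasure_compoundPoisson hF
  have hint : Integrable (fun z => χ (id z)) (compoundPoisson a F) :=
    χ.integrable_comp measurable_id
  rw [compoundPoisson_eq_sum] at hint
  have h := hasSum_integral_measure hint
  rw [← compoundPoisson_eq_sum] at h
  have h2 := (exp_series_hasSum_exp' (𝕂 := ℝ) (a • χ.mean F id)).const_smul (Real.exp (-a))
  rw [smul_sub, banach_exp_sub_smul_one]
  refine h.unique ?_
  convert! h2 using 1
  ext r
  rw [integral_smul_measure, ENNReal.toReal_ofReal (by positivity), Real.coe_toNNReal _ ha]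
  have hr : a ^ r • ∫ z, χ (id z) ∂(iidSumLaw F r) = a ^ r • χ.mean F id ^ r := by
    rcases hF with ha' | hF
    · have ha0 : a = 0 := le_antisymm ha' ha
      rcases Nat.eq_zero_or_pos r with rfl | hr
      · have := isProbabilityMeasure_iidSumLaw_zero F
        congr 1
        have e : (fun z => χ (id z)) =ᵐ[iidSumLaw F 0] fun _ => (1 : 𝔸) := by
          rw [iidSumLaw]
          refine (ae_map_iff (measurable_iidSum 0).aemeasurable MeasurableSet.of_discrete).2
            (Filter.Eventually.of_forall fun y => ?_)
          simp [χ.map_zero]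
        rw [integral_congr_ae e]
        simp
      · simp [ha0, hr.ne']
    · congr 1
      exact χ.mean_iidSumLaw F r
  rw [mul_div_right_comm, mul_smul, hr, smul_pow, smul_smul, smul_smul, smul_smul,
    div_eq_mul_inv]

variable {Ω : Type*} [MeasurableSpace Ω] {μ : Measure Ω} [IsProbabilityMeasure μ]

theorem isProbabilityMeasure_lawGivenNonzero {Y : Ω → ℤ} (hY : Measurable Y)
    (hp : probNonzero μ Y ≠ 0) : IsProbabilityMeasure (lawGivenNonzero μ Y) := by
  have : IsProbabilityMeasure (ProbabilityTheory.cond μ {ω | Y ω ≠ 0}) :=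
    cond_isProbabilityMeasure fun h => hp (by simp [probNonzero, measureReal_def, h])
  exact Measure.isProbabilityMeasure_map hY.aemeasurable

theorem BddChar.smul_mean_lawGivenNonzero {Y : Ω → ℤ} (hY : Measurable Y) :
    probNonzero μ Y • χ.mean (lawGivenNonzero μ Y) id = χ.jumpMean μ Y := by
  have hjump : χ.jumpMean μ Y = ∫ ω in {ω | Y ω ≠ 0}, χ (Y ω) ∂μ := by
    rw [BddChar.jumpMean, ← integral_indicator (measurableSet_ne_zero hY)]
    congr 1
    ext ω
    by_cases h : Y ω = 0 <;> simp [h]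
  by_cases hp : probNonzero μ Y = 0
  · have h0 := χ.norm_jumpMean_le (μ := μ) hY
    rw [hp] at h0 ⊢
    rw [zero_smul, norm_le_zero_iff.1 h0]
  · rw [hjump, BddChar.mean, lawGivenNonzero, integral_map hY.aemeasurable
      StronglyMeasurable.of_discrete.aestronglyMeasurable, ProbabilityTheory.cond,
      integral_smul_measure, ENNReal.toReal_inv, smul_smul]
    change (probNonzero μ Y * (probNonzero μ Y)⁻¹) • _ = _
    rw [mul_inv_cancel₀ hp, one_smul]
    rfl

theorem probNonzero_nonneg (μ : Measure Ω) (Y : Ω → ℤ) : 0 ≤ probNonzero μ Y := measureReal_nonneg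

theorem cpRate_nonneg (X : ℤ → Ω → ℤ) (n : ℕ) : 0 ≤ cpRate μ X n :=
  Finset.sum_nonneg fun _ _ => measureReal_nonneg

theorem isProbabilityMeasure_cpJumpLaw {X : ℤ → Ω → ℤ} {n : ℕ}
    (hX : ∀ i : ℤ, i ≤ n → Measurable (X i)) (hpos : 0 < cpRate μ X n) :
    IsProbabilityMeasure (cpJumpLaw μ X n) := by
  constructor
  rw [cpJumpLaw, Measure.finsetSum_apply]
  have : ∀ i ∈ Finset.Icc (1 : ℤ) n,
      (ENNReal.ofReal (probNonzero μ (X i) / cpRate μ X n) • lawGivenNonzero μ (X i)) Set.univ =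
        ENNReal.ofReal (probNonzero μ (X i) / cpRate μ X n) := fun i hi => by
    rw [Measure.smul_apply, smul_eq_mul]
    by_cases hp : probNonzero μ (X i) = 0
    · simp [hp]
    · have := isProbabilityMeasure_lawGivenNonzero (hX i (Finset.mem_Icc.1 hi).2) hp
      simp
  rw [Finset.sum_congr rfl this, ← ENNReal.ofReal_sum_of_nonneg fun i _ =>
    div_nonneg (probNonzero_nonneg μ (X i)) hpos.le, ← Finset.sum_div]
  change ENNReal.ofReal (cpRate μ X n / cpRate μ X n) = 1
  rw [div_self hpos.ne', ENNReal.ofReal_one]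

theorem cpRate_nonpos_or_isProbabilityMeasure {X : ℤ → Ω → ℤ} {n : ℕ}
    (hX : ∀ i : ℤ, i ≤ n → Measurable (X i)) :
    cpRate μ X n ≤ 0 ∨ IsProbabilityMeasure (cpJumpLaw μ X n) :=
  (le_or_gt (cpRate μ X n) 0).imp_right (isProbabilityMeasure_cpJumpLaw hX)

theorem isProbabilityMeasure_cpApprox {X : ℤ → Ω → ℤ} {n : ℕ}
    (hX : ∀ i : ℤ, i ≤ n → Measurable (X i)) : IsProbabilityMeasure (cpApprox μ X n) :=
  isProbabilityMeasure_compoundPoisson (cpRate_nonpos_or_isProbabilityMeasure hX)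

/-- As `λ_n F_n = ∑ p_i G_i`, the exponent `λ_n (E χ(F_n) - 1)` is a sum over `i` of the jump part
of `X_i` minus `p_i`, that is, of `E χ(X_i) - 1`. -/
theorem BddChar.mean_cpApprox {X : ℤ → Ω → ℤ} {n : ℕ}
    (hX : ∀ i : ℤ, i ≤ n → Measurable (X i)) :
    χ.mean (cpApprox μ X n) id = exp (∑ i ∈ Finset.Icc (1 : ℤ) n, (χ.mean μ (X i) - 1)) := by
  have hcp := cpRate_nonpos_or_isProbabilityMeasure (μ := μ) hX
  rw [cpApprox, χ.mean_compoundPoisson (cpRate_nonneg X n) hcp]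
  congr 1
  have hsum : ∑ i ∈ Finset.Icc (1 : ℤ) n, (χ.mean μ (X i) - 1) =
      ∑ i ∈ Finset.Icc (1 : ℤ) n, χ.jumpMean μ (X i) - cpRate μ X n • (1 : 𝔸) := by
    rw [cpRate, Finset.sum_smul, ← Finset.sum_sub_distrib]
    exact Finset.sum_congr rfl fun i hi => χ.mean_sub_one_eq (hX i (Finset.mem_Icc.1 hi).2)
  rw [hsum, smul_sub]
  congr 1
  rcases (cpRate_nonneg (μ := μ) X n).eq_or_lt with h0 | hpos
  -- At rate `0` all jump parts vanish, being bounded in norm by the probabilities `p_i`.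
  · rw [← h0, zero_smul]
    symm
    have hle : ‖∑ i ∈ Finset.Icc (1 : ℤ) n, χ.jumpMean μ (X i)‖ ≤ cpRate μ X n :=
      norm_sum_le_of_le _ fun i hi => χ.norm_jumpMean_le (hX i (Finset.mem_Icc.1 hi).2)
    rw [← h0] at hle
    exact norm_le_zero_iff.1 hle
  · have hF := isProbabilityMeasure_cpJumpLaw hX hpos
    have hint : Integrable (fun z => χ (id z)) (cpJumpLaw μ X n) :=
      χ.integrable_comp measurable_id
    rw [BddChar.mean]
    rw [cpJumpLaw] at hint ⊢
    rw [integral_finsetSum_measure fun i hi => (integrable_finsetSum_measure.1 hint) i hi,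
      Finset.smul_sum]
    refine Finset.sum_congr rfl fun i hi => ?_
    rw [integral_smul_measure, ENNReal.toReal_ofReal (div_nonneg (probNonzero_nonneg μ (X i)) hpos.le),
      smul_smul, mul_div_cancel₀ _ hpos.ne']
    exact χ.smul_mean_lawGivenNonzero (hX i (Finset.mem_Icc.1 hi).2)

end CompoundPoissonTransform

/-! ### Window functions of independent variables and the total variation bound -/

section MovingFunctions

variable {Ω : Type*} [MeasurableSpace Ω] {μ : Measure Ω} [IsProbabilityMeasure μ]

/-- Functions of windows contained in `S` are measurable functions of the variables in `S`. -/
theorem exists_measurable_eq_of_window {k n : ℕ} {Z : ℤ → Ω → ℝ} {h : ℤ → (Fin k → ℝ) → ℤ}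
    (hh : ∀ i : ℤ, 1 ≤ i → i ≤ n → Measurable (h i)) {X : ℤ → Ω → ℤ}
    (hX : ∀ i : ℤ, 1 ≤ i → i ≤ n → ∀ ω, X i ω = h i (fun r : Fin k => Z (i + (r : ℕ)) ω))
    (hX_zero : ∀ i : ℤ, i < 1 → ∀ ω, X i ω = 0) (S : Finset (Set.Ici (1 : ℤ))) (P : ℤ → Prop)
    [DecidablePred P] (hP : ∀ i, P i → i ≤ n)
    (hS : ∀ i, P i → 1 ≤ i → ∀ r : Fin k, ∃ j ∈ S, (j : ℤ) = i + (r : ℕ)) :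
    ∃ Φ : (S → ℝ) → (ℤ → ℤ), Measurable Φ ∧
      (fun ω (i : ℤ) => if P i then X i ω else 0) = Φ ∘ fun ω (j : S) => Z (j : Set.Ici (1 : ℤ)) ω := by
  classical
  refine ⟨fun z i => if hi : P i ∧ 1 ≤ i then
    h i (fun r => z ⟨(hS i hi.1 hi.2 r).choose, (hS i hi.1 hi.2 r).choose_spec.1⟩) else 0, ?_, ?_⟩
  · refine measurable_pi_iff.2 fun i => ?_
    by_cases hi : P i ∧ 1 ≤ i
    · simp only [hi, and_self, dite_true]
      exact (hh i hi.2 (hP i hi.1)).comp (measurable_pi_iff.2 fun r => measurable_pi_apply _)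
    · simp only [hi, dite_false]
      exact measurable_const
  · ext ω i
    simp only [Function.comp_apply]
    by_cases hi : P i ∧ 1 ≤ i
    · rw [if_pos hi.1, dif_pos hi, hX i hi.2 (hP i hi.1)]
      congr 1
      ext r
      rw [(hS i hi.1 hi.2 r).choose_spec.2]
    · rw [dif_neg hi]
      split_ifs with h1
      · exact hX_zero i (by by_contra hcon; exact hi ⟨h1, by omega⟩) ω
      · rfl

theorem locallyDependent_of_window {k n : ℕ} {Z : ℤ → Ω → ℝ}
    (hZ_meas : ∀ i : ℤ, 1 ≤ i → Measurable (Z i))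
    (hZ_indep : iIndepFun (fun i : Set.Ici (1 : ℤ) => Z i) μ) {h : ℤ → (Fin k → ℝ) → ℤ}
    (hh : ∀ i : ℤ, 1 ≤ i → i ≤ n → Measurable (h i)) {X : ℤ → Ω → ℤ}
    (hX : ∀ i : ℤ, 1 ≤ i → i ≤ n → ∀ ω, X i ω = h i (fun r : Fin k => Z (i + (r : ℕ)) ω))
    (hX_nonneg : ∀ i : ℤ, 1 ≤ i → i ≤ n → ∀ ω, 0 ≤ X i ω)
    (hX_zero : ∀ i : ℤ, i < 1 → ∀ ω, X i ω = 0)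
    (hX_L2 : ∀ i : ℤ, 1 ≤ i → i ≤ n → MemLp (fun ω => (X i ω : ℝ)) 2 μ) :
    LocallyDependent μ X k n where
  meas i hi := by
    rcases lt_or_ge i 1 with h1 | h1
    · rw [funext (hX_zero i h1)]
      exact measurable_const
    · rw [funext (hX i h1 hi)]
      exact (hh i h1 hi).comp (measurable_pi_iff.2 fun r => hZ_meas _ (by omega))
  nonneg i hi ω := by
    rcases lt_or_ge i 1 with h1 | h1
    · rw [hX_zero i h1]
    · exact hX_nonneg i h1 hi ω
  zero := hX_zero
  memLp i hi := by
    rcases lt_or_ge i 1 with h1 | h1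
    · simp [hX_zero i h1]
    · exact hX_L2 i h1 hi
  indep c := by
    -- Windows starting at or before `c` use `Z` up to index `c + k - 1`; those starting at `c + k`
    -- or later use only later indices.
    set S := (Finset.Icc (1 : ℤ) (c + k - 1)).subtype (· ∈ Set.Ici (1 : ℤ)) with hS
    set T := (Finset.Icc (c + k) ((n : ℤ) + k)).subtype (· ∈ Set.Ici (1 : ℤ)) with hT
    have hdisj : Disjoint S T := by
      rw [Finset.disjoint_left]
      intro x hx hx'
      simp only [hS, hT, Finset.mem_subtype, Finset.mem_Icc] at hx hx'
      omega
    have hind := hZ_indep.indepFun_finset S T hdisj fun i => hZ_meas i i.2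
    obtain ⟨Φ, hΦ, e1⟩ := exists_measurable_eq_of_window hh hX hX_zero S
      (fun i => i ≤ c ∧ i ≤ n) (fun i hi => hi.2) fun i hi h1 r =>
        ⟨⟨i + (r : ℕ), Set.mem_Ici.2 (by omega)⟩, by
          simp only [hS, Finset.mem_subtype, Finset.mem_Icc]
          have := r.2
          omega, rfl⟩
    obtain ⟨Ψ, hΨ, e2⟩ := exists_measurable_eq_of_window hh hX hX_zero T
      (fun i => c + k ≤ i ∧ i ≤ n) (fun i hi => hi.2) fun i hi h1 r =>
        ⟨⟨i + (r : ℕ), Set.mem_Ici.2 (by omega)⟩, by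
          simp only [hT, Finset.mem_subtype, Finset.mem_Icc]
          have := r.2
          omega, rfl⟩
    rw [e1, e2]
    exact hind.comp hΦ hΨ

theorem window_le_maxWindow (μ : Measure Ω) (X : ℤ → Ω → ℤ) (k n : ℕ) {i : ℤ} (h1 : 1 ≤ i)
    (hi : i ≤ n) :
    ∑ j ∈ Finset.Icc (i - 3 * k + 3) i, probNonzero μ (X j) ≤ maxWindow μ X k n :=
  le_ciSup (f := fun i : Finset.Icc (1 : ℤ) n =>
    ∑ j ∈ Finset.Icc ((i : ℤ) - 3 * k + 3) (i : ℤ), probNonzero μ (X j))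
    (Set.finite_range _).bddAbove ⟨i, Finset.mem_Icc.2 ⟨h1, hi⟩⟩

theorem one_sub_two_mul_pos_of_lt_log_two {m : ℝ} (hm : m < Real.log 2) :
    0 < 1 - 2 * (1 - Real.exp (-m)) := by
  have h : Real.exp (-Real.log 2) < Real.exp (-m) := Real.exp_lt_exp.2 (neg_lt_neg hm)
  rw [Real.exp_neg, Real.exp_log two_pos] at h
  linarith

/-- Compound Poisson approximation in total variation for locally dependent summands, in terms of
bounds for the replacement errors. -/
theorem LocallyDependent.dTV_le {X : ℤ → Ω → ℤ} {k n : ℕ} (hX : LocallyDependent μ X k n)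
    (hk : 1 ≤ k) (hm : maxWindow μ X k n < Real.log 2) {a β : ℤ → ℝ}
    (ha : ∀ i : ℤ, 1 ≤ i → i ≤ n → ‖shiftChar.replacement μ X 1 i‖ ≤ 4 * a i)
    (hβ : ∀ i : ℤ, 1 ≤ i → i ≤ n → ∃ κ : ShiftAlgebra, ‖κ‖ ≤ β i ∧
      shiftChar.replacement μ X (i - 2 * k + 2) i = (shiftChar 1 - 1) ^ 2 * κ) :
    dTV (μ.map fun ω => ∑ i ∈ Finset.Icc (1 : ℤ) n, X i ω) (cpApprox μ X n) ≤
      2 * ∑ i ∈ Finset.Icc (1 : ℤ) n,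
        (2 * ∑ j ∈ Finset.Icc (1 : ℤ) (i - 3 * k + 2), a j + gapWeight μ X k i) *
          (2 * localWeight μ X k i + probNonzero μ (X i) ^ 2)
      + smoothnessFactor (cpApprox μ X n) / (2 * (1 - 2 * (1 - Real.exp (-maxWindow μ X k n))))
        * ∑ i ∈ Finset.Icc (1 : ℤ) n, β i := by
  have hpos := one_sub_two_mul_pos_of_lt_log_two hm
  set θ := 1 - 2 * (1 - Real.exp (-maxWindow μ X k n)) with hθ
  have hS : Measurable (blockSum X 1 n) := hX.measurable_blockSum 1 le_rfl
  have hcp := isProbabilityMeasure_cpApprox (μ := μ) hX.meas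
  have hmap : IsProbabilityMeasure (μ.map (blockSum X 1 n)) :=
    Measure.isProbabilityMeasure_map hS.aemeasurable
  have hmean : shiftChar.mean (μ.map (blockSum X 1 n)) id = shiftChar.mean μ (blockSum X 1 n) :=
    integral_map hS.aemeasurable StronglyMeasurable.of_discrete.aestronglyMeasurable
  have hbound := hX.norm_mean_sub_exp_le shiftChar hk
    (fun i h1 hi => window_le_maxWindow μ X k n h1 hi) hpos ha hβ
  have hsm := shiftChar.norm_sq_mul_mean_le (cpApprox μ X n)
  have hβ0 : 0 ≤ ∑ i ∈ Finset.Icc (1 : ℤ) n, β i := Finset.sum_nonneg fun i hi => by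
    rw [Finset.mem_Icc] at hi
    obtain ⟨κ, hκ, -⟩ := hβ i hi.1 hi.2
    exact (norm_nonneg κ).trans hκ
  refine (dTV_le_norm_sub (μ.map (blockSum X 1 n)) (cpApprox μ X n)).trans ?_
  rw [shiftChar.mean_cpApprox hX.meas] at hsm ⊢
  rw [hmean]
  refine (mul_le_mul_of_nonneg_left hbound (by norm_num)).trans ?_
  rw [mul_add]
  refine add_le_add (le_of_eq ?_) ?_
  -- `1/2 (4a + 2g)(4w + 2p²) = 2 (2a + g)(2w + p²)`.
  · rw [Finset.mul_sum, Finset.mul_sum]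
    exact Finset.sum_congr rfl fun i _ => by ring
  rw [← mul_assoc]
  refine mul_le_mul_of_nonneg_right ?_ hβ0
  rw [div_mul_eq_div_div_swap, ← hθ, mul_comm, mul_one_div, div_le_div_iff_of_pos_right two_pos,
    div_le_div_iff_of_pos_right hpos]
  exact hsm

end MovingFunctions

end

theorem mainTheorem3 {Ω : Type*} [MeasurableSpace Ω] (μ : Measure Ω) [IsProbabilityMeasure μ]
    (k n : ℕ) (hk : 1 ≤ k)
    (Z : ℤ → Ω → ℝ) (hZ_meas : ∀ i : ℤ, 1 ≤ i → Measurable (Z i))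
    (hZ_indep : iIndepFun (fun i : Set.Ici (1 : ℤ) => Z i) μ)
    (h : ℤ → (Fin k → ℝ) → ℤ) (hh : ∀ i : ℤ, 1 ≤ i → i ≤ n → Measurable (h i))
    (X : ℤ → Ω → ℤ)
    (hX : ∀ i : ℤ, 1 ≤ i → i ≤ n → ∀ ω, X i ω = h i (fun r : Fin k => Z (i + (r : ℕ)) ω))
    (hX_nonneg : ∀ i : ℤ, 1 ≤ i → i ≤ n → ∀ ω, 0 ≤ X i ω)
    (hX_zero : ∀ i : ℤ, i < 1 → ∀ ω, X i ω = 0)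
    (hX_L2 : ∀ i : ℤ, 1 ≤ i → i ≤ n → MemLp (fun ω => (X i ω : ℝ)) 2 μ)
    (hm : maxWindow μ X k n < Real.log 2) :
    (dTV (μ.map fun ω => ∑ i ∈ Finset.Icc (1 : ℤ) n, X i ω) (cpApprox μ X n) ≤
      2 * ∑ i ∈ Finset.Icc (1 : ℤ) n,
        (2 * ∑ j ∈ Finset.Icc (1 : ℤ) (i - 3 * k + 2),
            (∑ t ∈ Finset.Icc (j - k + 1) (j - 1),
                (μ.real {ω | X t ω * X j ω ≠ 0} + probNonzero μ (X t) * probNonzero μ (X j))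
              + 1 / 2 * probNonzero μ (X j) ^ 2)
          + ∑ j ∈ Finset.Icc (i - 3 * k + 3) (i - 2 * k + 1), probNonzero μ (X j))
        * (2 * ∑ j ∈ Finset.Icc (i - k + 1) (i - 1),
              (μ.real {ω | X j ω ≠ 0 ∧ X i ω ≠ 0} + probNonzero μ (X i) * probNonzero μ (X j))
            + probNonzero μ (X i) ^ 2)
      + smoothnessFactor (cpApprox μ X n)
          / (2 * (1 - 2 * (1 - Real.exp (-maxWindow μ X k n))))
        * ∑ i ∈ Finset.Icc (1 : ℤ) n,
          (∑ j ∈ Finset.Icc (i - k + 1) (i - 1),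
              ((∫ ω, (X i ω : ℝ) * (X j ω : ℝ) ∂μ)
                + (∫ ω, (X i ω : ℝ) ∂μ) * (∫ ω, (X j ω : ℝ) ∂μ))
            + 1 / 2 * (∫ ω, (X i ω : ℝ) ∂μ) ^ 2))
    ∧
    ((∀ i j : ℤ, 1 ≤ j → j < i → i ≤ n →
        IsPQD μ (fun ω => ∑ t ∈ Finset.Icc j (i - 1), (X t ω : ℝ)) (fun ω => (X i ω : ℝ)) ∨
        IsNQD μ (fun ω => ∑ t ∈ Finset.Icc j (i - 1), (X t ω : ℝ)) (fun ω => (X i ω : ℝ))) →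
      dTV (μ.map fun ω => ∑ i ∈ Finset.Icc (1 : ℤ) n, X i ω) (cpApprox μ X n) ≤
      2 * ∑ i ∈ Finset.Icc (1 : ℤ) n,
        (2 * ∑ j ∈ Finset.Icc (1 : ℤ) (i - 3 * k + 2),
            (∑ t ∈ Finset.Icc (j - k + 1) (j - 1),
                |cov[fun ω => (X j ω : ℝ), fun ω => (X t ω : ℝ); μ]|
              + 1 / 2 * (∫ ω, (X j ω : ℝ) ∂μ) ^ 2)
          + ∑ j ∈ Finset.Icc (i - 3 * k + 3) (i - 2 * k + 1), probNonzero μ (X j))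
        * (2 * ∑ j ∈ Finset.Icc (i - k + 1) (i - 1),
              (μ.real {ω | X j ω ≠ 0 ∧ X i ω ≠ 0} + probNonzero μ (X i) * probNonzero μ (X j))
            + probNonzero μ (X i) ^ 2)
      + smoothnessFactor (cpApprox μ X n)
          / (2 * (1 - 2 * (1 - Real.exp (-maxWindow μ X k n))))
        * ∑ i ∈ Finset.Icc (1 : ℤ) n,
          (∑ j ∈ Finset.Icc (i - k + 1) (i - 1),
              |cov[fun ω => (X i ω : ℝ), fun ω => (X j ω : ℝ); μ]|
            + 1 / 2 * (∫ ω, (X i ω : ℝ) ∂μ) ^ 2)) := by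
  have hLD : LocallyDependent μ X k n :=
    locallyDependent_of_window hZ_meas hZ_indep hh hX hX_nonneg hX_zero hX_L2
  refine ⟨?_, fun hQD => ?_⟩
  -- The event `X_t X_j ≠ 0` in `C_n` is the event that both are non-zero.
  · have hloc : ∀ j : ℤ, ∑ t ∈ Finset.Icc (j - k + 1) (j - 1),
        (μ.real {ω | X t ω * X j ω ≠ 0} + probNonzero μ (X t) * probNonzero μ (X j)) =
        localWeight μ X k j := fun j => by
      refine Finset.sum_congr rfl fun t _ => ?_
      simp only [mul_ne_zero_iff]
      rw [mul_comm (probNonzero μ (X t))]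
    simp only [hloc]
    exact hLD.dTV_le hk hm (fun i _ hi => hLD.norm_replacement_one_le shiftChar hk hi)
      fun i _ hi => hLD.exists_replacement_eq shiftChar (by omega) hk hi
  · exact hLD.dTV_le hk hm
      (fun i _ hi => hLD.norm_replacement_one_le_of_quadrant shiftChar hk hi hQD)
      fun i _ hi => hLD.exists_replacement_eq_of_quadrant shiftChar (by omega) hk hi hQD
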